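/- Functions on $\mathbb T=\mathbb R/\mathbb Z$ are identified with $1$-periodic functions, and $|I|\in(0,1]$ denotes the length of an arc $I\subseteq\mathbb T$. For $r\ge 0$ put $$\Psi_{r,1}(t)=\frac{t}{\log^r(t+e)}\quad(t\ge 0),\qquad \rho_{\Psi_{r,1}}(t)=\frac{t^{-1}}{\Psi_{r,1}^{-1}(t^{-1})}\quad(t>0),$$ where $\Psi^{-1}(y)=\inf\{t\ge 0:\Psi(t)\ge y\}$ (the inverse function whenever $\Psi$ is increasing). Let $BMO(\rho_{\Psi_{r,1}})(\mathbb T)$ be the space of all $u\in L^2(\mathbb T)$ with $$\|u\|_{BMO(\rho_{\Psi_{r,1}})(\mathbb T)}:=\left(\sup_{I\subseteq\mathbb T\text{ arc}}\frac{1}{[\rho_{\Psi_{r,1}}(|I|)]^2|I|}\int_I|u-\langle u\rangle_I|^2\right)^{1/2}<\infty ,$$ where $\langle u\rangle_I$ is the mean of $u$ over $I$. For $n\in\mathbb N_0$ let $K_n(\theta)=\sum_{|j|\le n}\bigl(1-\frac{|j|}{n+1}\bigr)e^{2\pi i j\theta}$, and for $m\in\mathbb N$ let $V_m=2K_{2m+1}-K_m$,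 $\sigma_m=V_{2m}-V_m$, and let $\sigma_m^{+}$ and $\sigma_m^{-}$ be the parts of the trigonometric polynomial $\sigma_m$ with positive, respectively negative, frequencies. Let $K\subset\mathbb R$ be a bounded interval with integer endpoints $l_K'<r_K'$ and length $|K|=3\cdot 2^{l_K+1}$, $l_K\in\mathbb N_0$. Its non-central Whitney intervals are, for $l\in\mathbb N_0$, $$\left[l_K'+\tfrac{2^{-(l+1)}}{3}|K|,\ l_K'+\tfrac{2^{-l}}{3}|K|\right)\ \text{(left)},\qquad \left(r_K'-\tfrac{2^{-l}}{3}|K|,\ r_K'-\tfrac{2^{-(l+1)}}{3}|K|\right]\ \text{(right)};$$ the remaining (central) third of $K$ forms $\mathbf K^{\rm centre}$, and $W(K)$ is the family of all these intervals. For a non-central $J\in W(K)$ with $m:=|J|\in\mathbb N$ and endpoints $l_J<r_J$, put $\Delta_J(u)=\delta_J*u$, where $$\delta_J(\theta)=e^{2\pi i(r_J-2m)\theta}\,\sigma_m^{+}(\theta)\ \text{ if } J \text{ is left},\qquad \delta_J(\theta)=e^{2\pi i(l_J+2m)\theta}\,\sigma_m^{-}(\theta)\ \text{ if } J\text{ is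 right}.$$ **Theorem.** Let $r\ge 0$. There is a constant $C_r>0$ depending only on $r$ such that, for every collection $\mathcal K$ of mutually disjoint intervals of the real line with integer endpoints such that each $K\in\mathcal K$ has length $|K|=3\cdot 2^{l_K+1}$ for some $l_K\in\mathbb N_0$ and $0\notin K$, and for every $u\in BMO(\rho_{\Psi_{r,1}})(\mathbb T)$, $$\left(\sup_{I\subseteq\mathbb T\text{ arc}}\frac{1}{[\rho_{\Psi_{r,1}}(|I|)]^2|I|}\int_I\sum_{K\in\mathcal K}\ \sum_{\substack{J\in W(K)\setminus\mathbf K^{\rm centre}\\ |J|>|I|^{-1}}}|\Delta_J(u)(\theta)|^2\,d\theta\right)^{1/2}\le C_r\,\|u\|_{BMO(\rho_{\Psi_{r,1}})(\mathbb T)} .$$ -/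

import Mathlib

open MeasureTheory Set
open scoped ENNReal

noncomputable section

namespace LogBMO

/-! ### The growth functions and the weights -/

/-- The growth function `Ψ_{r,1}(t) = t / log^r (t + e)`, `t ≥ 0`. -/
def psi (r : ℝ) (t : ℝ) : ℝ := t / (Real.log (t + Real.exp 1)) ^ r

/-- The inverse of a growth function, `Ψ⁻¹(y) = inf {t ≥ 0 : Ψ(t) ≥ y}`. It is the inverse function
whenever `Ψ` is an increasing bijection of `[0, ∞)`; for large `r` the function `Ψ_{r,1}` is only
comparable to an increasing one, and this is then its generalised inverse. -/
def growthInv (Ψ : ℝ → ℝ) (y : ℝ) : ℝ := sInf {t : ℝ | 0 ≤ t ∧ y ≤ Ψ t}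

/-- `ρ_Ψ(t) = t⁻¹ / Ψ⁻¹(t⁻¹)`, `t > 0`. -/
def rho (Ψ : ℝ → ℝ) (t : ℝ) : ℝ := t⁻¹ / growthInv Ψ t⁻¹

/-! ### The space `BMO(ρ)` on the circle -/

/-- For `0 < s ≤ 1`: the arc of the circle `ℝ / ℤ` that starts at `a` and has length `s`. -/
def arc (a s : ℝ) : Set UnitAddCircle := (fun x : ℝ => (x : UnitAddCircle)) '' Ico a (a + s)

/-- `sup_I (1 / (ρ(|I|)² |I|)) ∫_I F I`, the supremum over all arcs `I`. The integrand may depend on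
the arc; an arc `I` is given by its starting point and its length. -/
def carlesonSup (ρ : ℝ → ℝ) (F : ℝ → ℝ → UnitAddCircle → ℝ≥0∞) : ℝ≥0∞ :=
  ⨆ (a : ℝ) (s : ℝ) (_ : 0 < s) (_ : s ≤ 1),
    (∫⁻ x in arc a s, F a s x) / ENNReal.ofReal (ρ s ^ 2 * s)

/-- The norm of `BMO(ρ)(𝕋)` (a seminorm: it vanishes on constants), built on squared deviations
from the mean over an arc. -/
def bmoNorm (ρ : ℝ → ℝ) (u : UnitAddCircle → ℂ) : ℝ≥0∞ :=
  (carlesonSup ρ fun a s x => ‖u x - ⨍ y in arc a s, u y‖ₑ ^ 2) ^ (1 / 2 : ℝ)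

/-- Membership in `BMO(ρ)(𝕋)`. -/
def MemBMO (ρ : ℝ → ℝ) (u : UnitAddCircle → ℂ) : Prop :=
  MemLp u 2 volume ∧ bmoNorm ρ u < ∞

/-! ### Fejér and de la Vallée Poussin kernels, through their Fourier coefficients -/

/-- The `j`-th Fourier coefficient of the Fejér kernel `K_n`. -/
def fejerCoeff (n : ℕ) (j : ℤ) : ℝ :=
  if |j| ≤ (n : ℤ) then 1 - |(j : ℝ)| / ((n : ℝ) + 1) else 0

/-- The `j`-th Fourier coefficient of the de la Vallée Poussin kernel `V_m = 2 K_{2m+1} - K_m`. -/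
def valleePoussinCoeff (m : ℕ) (j : ℤ) : ℝ := 2 * fejerCoeff (2 * m + 1) j - fejerCoeff m j

/-- The `j`-th Fourier coefficient of `σ_m = V_{2m} - V_m`. It vanishes unless
`m + 2 ≤ |j| ≤ 4m + 1`. -/
def sigmaCoeff (m : ℕ) (j : ℤ) : ℝ := valleePoussinCoeff (2 * m) j - valleePoussinCoeff m j

/-- The part of `σ_m` with positive frequencies. -/
def sigmaPos (m : ℕ) (x : UnitAddCircle) : ℂ :=
  ∑ j ∈ Finset.Icc (1 : ℤ) (4 * m + 1), (sigmaCoeff m j : ℂ) * fourier j x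

/-- The part of `σ_m` with negative frequencies. -/
def sigmaNeg (m : ℕ) (x : UnitAddCircle) : ℂ :=
  ∑ j ∈ Finset.Icc (-(4 * m + 1) : ℤ) (-1), (sigmaCoeff m j : ℂ) * fourier j x

/-! ### Whitney intervals and the associated projections -/

/-- The length of a bounded non-empty interval. -/
def len (K : Set ℝ) : ℝ := sSup K - sInf K

/-- The left Whitney intervals of `K`, from the centre (`l = 0`) towards the left endpoint. -/
def whitneyLeft (K : Set ℝ) (l : ℕ) : Set ℝ :=
  Ico (sInf K + (2 : ℝ)⁻¹ ^ (l + 1) / 3 * len K) (sInf K + (2 : ℝ)⁻¹ ^ l / 3 * len K)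

/-- The right Whitney intervals of `K`, from the centre (`l = 0`) towards the right endpoint. -/
def whitneyRight (K : Set ℝ) (l : ℕ) : Set ℝ :=
  Ioc (sSup K - (2 : ℝ)⁻¹ ^ l / 3 * len K) (sSup K - (2 : ℝ)⁻¹ ^ (l + 1) / 3 * len K)

/-- The kernel `δ_J` of a left Whitney interval `J` with integer endpoints: with `m = |J|` and
`r_J` the right endpoint of `J`, this is `e^{2πi (r_J - 2m) θ} σ_m⁺`. -/
def deltaLeft (J : Set ℝ) (x : UnitAddCircle) : ℂ :=
  fourier (⌊sSup J⌋ - 2 * ⌊len J⌋) x * sigmaPos ⌊len J⌋₊ x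

/-- The kernel `δ_J` of a right Whitney interval `J` with integer endpoints: with `m = |J|` and
`l_J` the left endpoint of `J`, this is `e^{2πi (l_J + 2m) θ} σ_m⁻`. -/
def deltaRight (J : Set ℝ) (x : UnitAddCircle) : ℂ :=
  fourier (⌊sInf J⌋ + 2 * ⌊len J⌋) x * sigmaNeg ⌊len J⌋₊ x

/-- Convolution on the circle `ℝ / ℤ`. -/
def conv (f g : UnitAddCircle → ℂ) (x : UnitAddCircle) : ℂ := ∫ y, f (x - y) * g y

/-- `∑_{K ∈ 𝒦} ∑_J |Δ_J(u)|²`, where `Δ_J(u) = δ_J ∗ u` and `J` runs over the non-central Whitney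
intervals of `K` with `|J| > s⁻¹`. -/
def squareFun (𝒦 : Set (Set ℝ)) (u : UnitAddCircle → ℂ) (s : ℝ) (x : UnitAddCircle) : ℝ≥0∞ :=
  ∑' K : 𝒦,
    ((∑' l : {l : ℕ // s⁻¹ < len (whitneyLeft K l)},
        ‖conv (deltaLeft (whitneyLeft K l)) u x‖ₑ ^ 2) +
      ∑' l : {l : ℕ // s⁻¹ < len (whitneyRight K l)},
        ‖conv (deltaRight (whitneyRight K l)) u x‖ₑ ^ 2)

end LogBMO

end

namespace LogBMO

/-! ### Coefficients of the de la Vallée Poussin differences -/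

/-! A left Whitney interval of `K` of length `m` has right endpoint `a + 2m`, where `a` is the left
endpoint of `K`. Hence `δ_J` is the positive part of `σ_m` shifted by `a`, with the same anchor for
every left `J`; the right ones are anchored in the same way at the right endpoint. For an arc `I`
only `|J| > |I|⁻¹ ≥ 1` enters, so the square function is a sum of blocks at dyadic scales `m = 2 ^
i` (`squareFun_le`). The frequencies of the blocks of one `K` lie inside `K`, so disjoint `K` use
disjoint nonzero frequencies. In particular a constant `c` can be subtracted from `u`.

Let `c` be the mean of `u` over the doubled arc `2I`, and split `u - c` into its parts `f` on `2I`
and `g` off it (`lintegral_arc_blockSquare_le`).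

Near part: by Parseval the full integral of the square function of `f` is at most `‖f‖₂²`, because
the squared multipliers of all scales sum to at most 1 at each frequency
(`lintegral_blockSquare_le`).

Far part: the bound is pointwise in `x ∈ I`. Since `g` vanishes near `x`, it equals `(e^{2πiε(x-y)}
- 1) h(y)` with `h` in `L²`, so its coefficients are twisted differences of those of `h`. Summation
by parts moves the difference onto `σ_m`, whose increments are `O(1/m)`; Cauchy–Schwarz leaves a
factor `O(1/m)` times a sum of `|ĥ|²`. Summing over `K` by Parseval and over `m > |I|⁻¹` gives
`O(|I|) ∫ |g(y)|² / |x - y|² dy` (`blockSquare_le_of_eq_zero`).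

This integral is summed over dyadic annuli around `I`. The weight grows by at most `5/4` per
doubling, up to a constant (`exists_rho_psi_le`), so `∫ |u - c|²` over the arc of length about `2 ^
k |I|` is `O((25/8) ^ k)`. Against the decay `4 ^ (-k)` this is a geometric series of ratio `25/32`.
Any growth factor below `√2` would serve. -/

lemma fejerCoeff_eq_max (n : ℕ) (j : ℤ) :
    fejerCoeff n j = max 0 (1 - |(j : ℝ)| / ((n : ℝ) + 1)) := by
  have hn : (0 : ℝ) < (n : ℝ) + 1 := by positivity
  unfold fejerCoeff
  split_ifs with h
  · have h' : |(j : ℝ)| ≤ n := by exact_mod_cast h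
    rw [max_eq_right]
    rw [sub_nonneg, div_le_one hn]
    linarith
  · have h' : (n : ℝ) + 1 ≤ |(j : ℝ)| := by
      have : (n : ℤ) + 1 ≤ |j| := by omega
      exact_mod_cast this
    rw [max_eq_left]
    rw [sub_nonpos, le_div_iff₀ hn]
    linarith

/-- A trapezoid: 1 up to `|j| = m + 1`, then linear down to 0 at `2(m + 1)`. Bounds, monotonicity in
`m` and the Lipschitz constant are read off from this form. -/
lemma valleePoussinCoeff_eq_clamp (m : ℕ) (j : ℤ) :
    valleePoussinCoeff m j = max 0 (min 1 (2 - |(j : ℝ)| / ((m : ℝ) + 1))) := by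
  have hm : (0 : ℝ) < (m : ℝ) + 1 := by positivity
  have h2 : |(j : ℝ)| / (((2 * m + 1 : ℕ) : ℝ) + 1) = |(j : ℝ)| / ((m : ℝ) + 1) / 2 := by
    push_cast
    field_simp
    ring
  rw [valleePoussinCoeff, fejerCoeff_eq_max, fejerCoeff_eq_max, h2]
  generalize |(j : ℝ)| / ((m : ℝ) + 1) = x
  rcases max_cases 0 (1 - x / 2) with h | h <;> rcases max_cases 0 (1 - x) with h' | h' <;>
    rcases min_cases 1 (2 - x) with h'' | h'' <;>
    rcases max_cases 0 (min 1 (2 - x)) with h3 | h3 <;> linarith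

lemma valleePoussinCoeff_nonneg (m : ℕ) (j : ℤ) : 0 ≤ valleePoussinCoeff m j := by
  rw [valleePoussinCoeff_eq_clamp]
  exact le_max_left _ _

lemma valleePoussinCoeff_le_one (m : ℕ) (j : ℤ) : valleePoussinCoeff m j ≤ 1 := by
  rw [valleePoussinCoeff_eq_clamp]
  exact max_le zero_le_one (min_le_left _ _)

lemma valleePoussinCoeff_mono {m n : ℕ} (h : m ≤ n) (j : ℤ) :
    valleePoussinCoeff m j ≤ valleePoussinCoeff n j := by
  simp only [valleePoussinCoeff_eq_clamp]
  gcongr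

lemma abs_valleePoussinCoeff_sub_le (m : ℕ) (j : ℤ) :
    |valleePoussinCoeff m j - valleePoussinCoeff m (j + 1)| ≤ 1 / ((m : ℝ) + 1) := by
  have hm : (0 : ℝ) < (m : ℝ) + 1 := by positivity
  simp only [valleePoussinCoeff_eq_clamp]
  refine (abs_max_sub_max_le_max _ _ _ _).trans ?_
  refine max_le (by simp; positivity) ?_
  refine (abs_min_sub_min_le_max _ _ _ _).trans ?_
  refine max_le (by simp; positivity) ?_
  rw [sub_sub_sub_cancel_left, ← sub_div, abs_div, abs_of_pos hm]
  gcongr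
  refine (abs_abs_sub_abs_le_abs_sub _ _).trans ?_
  push_cast
  simp

lemma sigmaCoeff_neg (m : ℕ) (j : ℤ) : sigmaCoeff m (-j) = sigmaCoeff m j := by
  simp [sigmaCoeff, valleePoussinCoeff_eq_clamp]

lemma sigmaCoeff_nonneg (m : ℕ) (j : ℤ) : 0 ≤ sigmaCoeff m j :=
  sub_nonneg.2 (valleePoussinCoeff_mono (by omega) j)

lemma sigmaCoeff_le_one (m : ℕ) (j : ℤ) : sigmaCoeff m j ≤ 1 := by
  have h₁ := valleePoussinCoeff_le_one (2 * m) j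
  have h₂ := valleePoussinCoeff_nonneg m j
  unfold sigmaCoeff
  linarith

lemma sigmaCoeff_zero (m : ℕ) : sigmaCoeff m 0 = 0 := by
  simp [sigmaCoeff, valleePoussinCoeff_eq_clamp]

/-- Removes the upper boundary term in the summation by parts; `sigmaCoeff_zero` removes the lower
one. -/
lemma sigmaCoeff_four_mul_add_two (m : ℕ) : sigmaCoeff m (4 * m + 2) = 0 := by
  have hm : (0 : ℝ) < (m : ℝ) + 1 := by positivity
  have hj : |(((4 * m + 2 : ℤ)) : ℝ)| = 4 * (m : ℝ) + 2 := by
    push_cast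
    exact abs_of_nonneg (by positivity)
  have h₁ : (2 : ℝ) - (4 * (m : ℝ) + 2) / (((2 * m : ℕ) : ℝ) + 1) ≤ 0 := by
    push_cast
    rw [sub_nonpos, le_div_iff₀ (by positivity)]
    linarith
  have h₂ : (2 : ℝ) - (4 * (m : ℝ) + 2) / ((m : ℝ) + 1) ≤ 0 := by
    have : (0 : ℝ) ≤ m := by positivity
    rw [sub_nonpos, le_div_iff₀ (by positivity)]
    linarith
  rw [sigmaCoeff, valleePoussinCoeff_eq_clamp, valleePoussinCoeff_eq_clamp, hj,
    max_eq_left ((min_le_right _ _).trans h₁), max_eq_left ((min_le_right _ _).trans h₂), sub_zero]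

lemma abs_sigmaCoeff_sub_le {m : ℕ} (hm : 0 < m) (j : ℤ) :
    |sigmaCoeff m j - sigmaCoeff m (j + 1)| ≤ 2 / m := by
  have hm' : (0 : ℝ) < m := by exact_mod_cast hm
  have h₁ := abs_valleePoussinCoeff_sub_le (2 * m) j
  have h₂ := abs_valleePoussinCoeff_sub_le m j
  have h₃ : 1 / (((2 * m : ℕ) : ℝ) + 1) ≤ 1 / m := by
    apply one_div_le_one_div_of_le hm'
    push_cast
    linarith
  have h₄ : 1 / ((m : ℝ) + 1) ≤ 1 / m := one_div_le_one_div_of_le hm' (by linarith)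
  have h₅ : (2 : ℝ) / m = 1 / m + 1 / m := by ring
  have h₆ := abs_sub (valleePoussinCoeff (2 * m) j - valleePoussinCoeff (2 * m) (j + 1))
    (valleePoussinCoeff m j - valleePoussinCoeff m (j + 1))
  calc |sigmaCoeff m j - sigmaCoeff m (j + 1)|
      = |(valleePoussinCoeff (2 * m) j - valleePoussinCoeff (2 * m) (j + 1)) -
          (valleePoussinCoeff m j - valleePoussinCoeff m (j + 1))| := by
        unfold sigmaCoeff
        congr 1
        ring
    _ ≤ 2 / m := by linarith

/-- Values in `[0, 1]` give `σ² ≤ σ`, and at dyadic scales `σ` is a difference of consecutive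
trapezoids, so the sum telescopes. -/
lemma sum_sigmaCoeff_sq_le_one (n : ℕ) (j : ℤ) :
    ∑ i ∈ Finset.range n, sigmaCoeff (2 ^ i) j ^ 2 ≤ 1 := by
  calc ∑ i ∈ Finset.range n, sigmaCoeff (2 ^ i) j ^ 2
      ≤ ∑ i ∈ Finset.range n, (valleePoussinCoeff (2 ^ (i + 1)) j - valleePoussinCoeff (2 ^ i) j) := by
        refine Finset.sum_le_sum fun i _ => ?_
        have h : sigmaCoeff (2 ^ i) j
            = valleePoussinCoeff (2 ^ (i + 1)) j - valleePoussinCoeff (2 ^ i) j := by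
          rw [sigmaCoeff, pow_succ']
        rw [← h]
        nlinarith [sigmaCoeff_nonneg (2 ^ i) j, sigmaCoeff_le_one (2 ^ i) j]
    _ = valleePoussinCoeff (2 ^ n) j - valleePoussinCoeff (2 ^ 0) j :=
        Finset.sum_range_sub (fun i => valleePoussinCoeff (2 ^ i) j) n
    _ ≤ 1 := by
        have h₁ := valleePoussinCoeff_le_one (2 ^ n) j
        have h₂ := valleePoussinCoeff_nonneg (2 ^ 0) j
        linarith

lemma tsum_sigmaCoeff_sq_le_one (j : ℤ) :
    ∑' i : ℕ, ENNReal.ofReal (sigmaCoeff (2 ^ i) j ^ 2) ≤ 1 := by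
  rw [ENNReal.tsum_eq_iSup_nat]
  refine iSup_le fun n => ?_
  rw [← ENNReal.ofReal_sum_of_nonneg fun i _ => sq_nonneg _]
  exact ENNReal.ofReal_le_one.2 (sum_sigmaCoeff_sq_le_one n j)

/-! ### Regularity of the weight -/

lemma one_le_log_add_exp {t : ℝ} (ht : 0 ≤ t) : 1 ≤ Real.log (t + Real.exp 1) := by
  rw [Real.le_log_iff_exp_le (by positivity)]
  linarith

lemma psi_le_self {r : ℝ} (hr : 0 ≤ r) {t : ℝ} (ht : 0 ≤ t) : psi r t ≤ t :=
  div_le_self ht (Real.one_le_rpow (one_le_log_add_exp ht) hr)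

/-- Since both logarithms of shifted arguments are at least 1, `log (lt + e) ≤ log l + log (t + e) ≤
(1 + log l) log (t + e)`. This replaces monotonicity of `psi r`, which may fail for large `r`. -/
lemma mul_psi_le_psi_mul {r : ℝ} (hr : 0 ≤ r) {t l : ℝ} (ht : 0 ≤ t) (hl : 1 ≤ l) :
    l / (1 + Real.log l) ^ r * psi r t ≤ psi r (l * t) := by
  have h₁ := one_le_log_add_exp ht
  have h₂ := one_le_log_add_exp (t := l * t) (by positivity)
  have hlog : 0 ≤ Real.log l := Real.log_nonneg hl
  have h₃ : Real.log (l * t + Real.exp 1) ≤ (1 + Real.log l) * Real.log (t + Real.exp 1) := by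
    calc Real.log (l * t + Real.exp 1) ≤ Real.log (l * (t + Real.exp 1)) := by
          apply Real.log_le_log (by positivity)
          nlinarith [Real.exp_pos 1]
      _ = Real.log l + Real.log (t + Real.exp 1) := Real.log_mul (by positivity) (by positivity)
      _ ≤ _ := by nlinarith
  have h₄ : Real.log (l * t + Real.exp 1) ^ r
      ≤ (1 + Real.log l) ^ r * Real.log (t + Real.exp 1) ^ r := by
    rw [← Real.mul_rpow (by positivity) (by positivity)]
    exact Real.rpow_le_rpow (by positivity) h₃ hr
  unfold psi
  rw [div_mul_div_comm]
  gcongr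

lemma exists_one_add_log_rpow_le {r : ℝ} (hr : 0 ≤ r) :
    ∃ C : ℝ, 1 ≤ C ∧ ∀ l : ℝ, 1 ≤ l → (1 + Real.log l) ^ r ≤ C * l ^ (1 / 5 : ℝ) := by
  -- Chosen so that `e * r ≤ 1 / 5`.
  set e : ℝ := 1 / (5 * (r + 1)) with he
  have he0 : 0 < e := by positivity
  refine ⟨(1 + 1 / e) ^ r, Real.one_le_rpow (by simp; positivity) hr, fun l hl => ?_⟩
  have h₁ : Real.log l ≤ l ^ e / e := Real.log_le_rpow_div (by positivity) he0
  have h₂ : 1 ≤ l ^ e := Real.one_le_rpow hl he0.le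
  have h₃ : 1 + Real.log l ≤ (1 + 1 / e) * l ^ e := by
    have : (1 + 1 / e) * l ^ e = l ^ e + l ^ e / e := by ring
    linarith
  calc (1 + Real.log l) ^ r ≤ ((1 + 1 / e) * l ^ e) ^ r :=
        Real.rpow_le_rpow (by linarith [Real.log_nonneg hl]) h₃ hr
    _ = (1 + 1 / e) ^ r * l ^ (e * r) := by
        rw [Real.mul_rpow (by positivity) (by positivity), ← Real.rpow_mul (by positivity)]
    _ ≤ _ := by
        gcongr
        · rw [he, div_mul_eq_mul_div, div_le_div_iff₀ (by positivity) (by positivity)]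
          linarith

/-- Makes the infimum in `growthInv` run over a nonempty set, so that it is not the default value 0.
-/
lemma exists_le_psi {r : ℝ} (hr : 0 ≤ r) (y : ℝ) : ∃ t : ℝ, 0 ≤ t ∧ y ≤ psi r t := by
  obtain ⟨C, hC, h⟩ := exists_one_add_log_rpow_le hr
  have hp : 0 < psi r 1 :=
    div_pos one_pos (Real.rpow_pos_of_pos (one_pos.trans_le (one_le_log_add_exp zero_le_one)) _)
  set B : ℝ := max 1 (C * y / psi r 1) with hB
  have hB1 : 1 ≤ B := le_max_left _ _
  have hB0 : 0 < B := one_pos.trans_le hB1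
  -- The solution of `l / l ^ (1/5) = B`.
  set l : ℝ := B ^ (5 / 4 : ℝ) with hl
  have hl1 : 1 ≤ l := Real.one_le_rpow hB1 (by norm_num)
  have hl0 : 0 < l := one_pos.trans_le hl1
  have hlog : 0 ≤ Real.log l := Real.log_nonneg hl1
  refine ⟨l * 1, by positivity, le_trans ?_ (mul_psi_le_psi_mul hr zero_le_one hl1)⟩
  have h₁ : B / C ≤ l / (1 + Real.log l) ^ r := by
    rw [div_le_div_iff₀ (by positivity) (by positivity)]
    calc B * (1 + Real.log l) ^ r ≤ B * (C * l ^ (1 / 5 : ℝ)) := by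
          gcongr
          exact h l hl1
      _ = l * C := by
          have : l = B * l ^ (1 / 5 : ℝ) := by
            rw [hl, ← Real.rpow_mul hB0.le]
            nth_rewrite 2 [← Real.rpow_one B]
            rw [← Real.rpow_add hB0]
            norm_num
          nth_rewrite 2 [this]
          ring
  calc y = C * y / psi r 1 / C * psi r 1 := by field_simp
    _ ≤ B / C * psi r 1 := by
        gcongr
        exact le_max_right _ _
    _ ≤ _ := by gcongr

lemma le_growthInv_psi {r : ℝ} (hr : 0 ≤ r) (y : ℝ) : y ≤ growthInv (psi r) y :=
  le_csInf (exists_le_psi hr y) fun _ ht => ht.2.trans (psi_le_self hr ht.1)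

/-- If `t` is admissible in the infimum for `y`, then `l * t` is admissible in the one for `z`. -/
lemma growthInv_psi_le_mul {r : ℝ} (hr : 0 ≤ r) {y z l : ℝ} (hl : 1 ≤ l)
    (h : z * (1 + Real.log l) ^ r ≤ l * y) :
    growthInv (psi r) z ≤ l * growthInv (psi r) y := by
  have hl0 : 0 < l := one_pos.trans_le hl
  have hlog : 0 ≤ Real.log l := Real.log_nonneg hl
  rw [← div_le_iff₀' hl0]
  refine le_csInf (exists_le_psi hr y) fun t ht => ?_
  rw [div_le_iff₀' hl0]
  refine csInf_le ⟨0, fun _ h => h.1⟩ ⟨by have := ht.1; positivity, ?_⟩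
  refine le_trans ?_ (mul_psi_le_psi_mul hr ht.1 hl)
  calc z ≤ l * y / (1 + Real.log l) ^ r := (le_div_iff₀ (by positivity)).2 h
    _ = l / (1 + Real.log l) ^ r * y := by ring
    _ ≤ _ := by
      gcongr
      exact ht.2

lemma rho_psi_pos {r : ℝ} (hr : 0 ≤ r) {s : ℝ} (hs : 0 < s) : 0 < rho (psi r) s :=
  div_pos (by positivity) ((by positivity : 0 < s⁻¹).trans_le (le_growthInv_psi hr _))

/-- The weight grows at most like the power `log₂ (5/4)` of the length. -/
lemma exists_rho_psi_le {r : ℝ} (hr : 0 ≤ r) :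
    ∃ A : ℝ, 1 ≤ A ∧ ∀ (j : ℕ) (s t : ℝ), 0 < s → s ≤ t → t ≤ 2 ^ j * s →
      rho (psi r) t ≤ A * (5 / 4) ^ j * rho (psi r) s := by
  obtain ⟨C, hC, h⟩ := exists_one_add_log_rpow_le hr
  have hC0 : 0 < C := one_pos.trans_le hC
  refine ⟨C ^ 2, one_le_pow₀ hC, fun j s t hs hst ht => ?_⟩
  have ht0 : 0 < t := hs.trans_le hst
  -- The dilation `l = q t / s` must satisfy `(1 + log l) ^ r ≤ q`. This holds because `l ≤ C ^ 2
  -- (5/2) ^ j` and `5/2 ≤ (5/4) ^ 5`, which is why the power `1/5` was used.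
  set q : ℝ := C ^ 2 * (5 / 4) ^ j with hq
  have hq1 : 1 ≤ q := one_le_mul_of_one_le_of_one_le (one_le_pow₀ hC)
    (one_le_pow₀ (by norm_num))
  have hts : 1 ≤ t / s := (one_le_div hs).2 hst
  have htj : t / s ≤ 2 ^ j := (div_le_iff₀ hs).2 ht
  set l : ℝ := q * (t / s) with hl
  have hl1 : 1 ≤ l := one_le_mul_of_one_le_of_one_le hq1 hts
  have hlq : (1 + Real.log l) ^ r ≤ q := by
    refine (h l hl1).trans ?_
    have h₁ : l ≤ (C * (5 / 4) ^ j) ^ 5 := by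
      calc l ≤ C ^ 2 * (5 / 4) ^ j * 2 ^ j := by rw [hl, hq]; gcongr
        _ = C ^ 2 * (5 / 2) ^ j := by
            rw [mul_assoc, ← mul_pow]
            norm_num
        _ ≤ C ^ 5 * ((5 / 4) ^ 5) ^ j := by
            gcongr <;> norm_num
        _ = _ := by rw [mul_pow, ← pow_mul, ← pow_mul, mul_comm j]
    have h₂ : l ^ (1 / 5 : ℝ) ≤ C * (5 / 4) ^ j := by
      calc l ^ (1 / 5 : ℝ) ≤ ((C * (5 / 4) ^ j) ^ 5) ^ (1 / 5 : ℝ) :=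
            Real.rpow_le_rpow (by positivity) h₁ (by norm_num)
        _ = C * (5 / 4) ^ j := by
            rw [← Real.rpow_natCast, ← Real.rpow_mul (by positivity)]
            norm_num
    calc C * l ^ (1 / 5 : ℝ) ≤ C * (C * (5 / 4) ^ j) := by gcongr
      _ = q := by rw [hq]; ring
  have hG := growthInv_psi_le_mul hr (y := t⁻¹) (z := s⁻¹) hl1 (by
    calc s⁻¹ * (1 + Real.log l) ^ r ≤ s⁻¹ * q := by gcongr
      _ = l * t⁻¹ := by rw [hl]; field_simp)
  have hGt : 0 < growthInv (psi r) t⁻¹ := (by positivity : 0 < t⁻¹).trans_le (le_growthInv_psi hr _)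
  have hGs : 0 < growthInv (psi r) s⁻¹ := (by positivity : 0 < s⁻¹).trans_le (le_growthInv_psi hr _)
  unfold rho
  rw [mul_div_assoc', div_le_div_iff₀ hGt hGs]
  calc t⁻¹ * growthInv (psi r) s⁻¹ ≤ t⁻¹ * (l * growthInv (psi r) t⁻¹) := by gcongr
    _ = q * s⁻¹ * growthInv (psi r) t⁻¹ := by rw [hl]; field_simp

/-! ### Fourier analysis on the circle -/

lemma volume_eq_haarAddCircle :
    (volume : Measure UnitAddCircle) = AddCircle.haarAddCircle := by
  simp [AddCircle.volume_eq_smul_haarAddCircle]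

lemma hasSum_norm_fourierCoeff_sq_of_ae_eq {T : ℝ} [Fact (0 < T)] {f : AddCircle T → ℂ}
    (F : Lp ℂ 2 (AddCircle.haarAddCircle (T := T)))
    (hF : F =ᵐ[AddCircle.haarAddCircle] f) :
    HasSum (fun n => ‖fourierCoeff f n‖ ^ 2) (∫ t, ‖f t‖ ^ 2 ∂AddCircle.haarAddCircle) := by
  have h := hasSum_sq_fourierCoeff F
  rw [fourierCoeff_congr_ae hF] at h
  have hi : ∫ t, ‖F t‖ ^ 2 ∂AddCircle.haarAddCircle
      = ∫ t, ‖f t‖ ^ 2 ∂AddCircle.haarAddCircle := by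
    refine integral_congr_ae ?_
    filter_upwards [hF] with t ht
    rw [ht]
  rwa [hi] at h

lemma hasSum_norm_fourierCoeff_sq {T : ℝ} [Fact (0 < T)] {f : AddCircle T → ℂ}
    (hf : MemLp f 2 AddCircle.haarAddCircle) :
    HasSum (fun n => ‖fourierCoeff f n‖ ^ 2) (∫ t, ‖f t‖ ^ 2 ∂AddCircle.haarAddCircle) :=
  hasSum_norm_fourierCoeff_sq_of_ae_eq (hf.toLp f) hf.coeFn_toLp

lemma tsum_enorm_fourierCoeff_sq {f : UnitAddCircle → ℂ} (hf : MemLp f 2 volume) :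
    ∑' n, ‖fourierCoeff f n‖ₑ ^ 2 = ∫⁻ x, ‖f x‖ₑ ^ 2 := by
  have hf' : MemLp f 2 AddCircle.haarAddCircle := hf.haarAddCircle
  have h := hasSum_norm_fourierCoeff_sq hf'
  have hint : Integrable (fun t => ‖f t‖ ^ 2) volume := hf.integrable_norm_pow two_ne_zero
  have e₁ : ∑' n, ‖fourierCoeff f n‖ₑ ^ 2 = ENNReal.ofReal (∑' n, ‖fourierCoeff f n‖ ^ 2) := by
    rw [ENNReal.ofReal_tsum_of_nonneg (fun _ => sq_nonneg _) h.summable]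
    refine tsum_congr fun n => ?_
    rw [ENNReal.ofReal_pow (norm_nonneg _), ofReal_norm]
  have e₂ : ∫⁻ t, ‖f t‖ₑ ^ 2 = ENNReal.ofReal (∫ t, ‖f t‖ ^ 2) := by
    rw [ofReal_integral_eq_lintegral_ofReal hint
      (Filter.Eventually.of_forall fun _ => sq_nonneg _)]
    refine lintegral_congr fun t => ?_
    rw [ENNReal.ofReal_pow (norm_nonneg _), ofReal_norm]
  rw [e₁, e₂, h.tsum_eq, AddCircle.integral_haarAddCircle]
  simp

lemma lintegral_enorm_sq_sum_fourier {ι : Type*} (s : Finset ι) {φ : ι → ℤ}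
    (hφ : Function.Injective φ) (b : ι → ℂ) :
    ∫⁻ x : UnitAddCircle, ‖∑ j ∈ s, b j * fourier (φ j) x‖ₑ ^ 2 = ∑ j ∈ s, ‖b j‖ₑ ^ 2 := by
  classical
  set f : UnitAddCircle → ℂ := fun x => ∑ j ∈ s, b j * fourier (φ j) x with hfdef
  have hcont : Continuous f := by fun_prop
  have hf : MemLp f 2 volume := hcont.memLp_of_hasCompactSupport (HasCompactSupport.of_compactSpace _)
  have hint : ∀ j ∈ s, Integrable (fun x : UnitAddCircle => b j * fourier (φ j) x)
      AddCircle.haarAddCircle := fun j _ =>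
    (by fun_prop : Continuous fun x : UnitAddCircle => b j * fourier (φ j) x)
      |>.integrable_of_hasCompactSupport (HasCompactSupport.of_compactSpace _)
  have hcoeff : ∀ k, fourierCoeff f k = ∑ j ∈ s, if φ j = k then b j else 0 := by
    intro k
    have : f = ∑ j ∈ s, fun x => b j * fourier (φ j) x := by
      ext x
      simp [hfdef]
    rw [this, fourierCoeff.sum s _ hint, Finset.sum_apply]
    refine Finset.sum_congr rfl fun j _ => ?_
    rw [fourierCoeff.const_mul, fourierCoeff_fourier]
    simp [Pi.single_apply, eq_comm]
  rw [← tsum_enorm_fourierCoeff_sq hf, tsum_eq_sum (s := s.image φ), Finset.sum_image hφ.injOn]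
  · refine Finset.sum_congr rfl fun j hj => ?_
    rw [hcoeff]
    simp [hφ.eq_iff, hj]
  · intro k hk
    rw [hcoeff, Finset.sum_eq_zero]
    · simp
    · intro j hj
      rw [if_neg]
      rintro rfl
      exact hk (Finset.mem_image_of_mem _ hj)

lemma fourier_sub_apply (n : ℤ) (x y : UnitAddCircle) :
    (fourier n (x - y) : ℂ) = fourier n x * fourier (-n) y := by
  simp only [fourier_apply]
  rw [smul_sub, sub_eq_add_neg, AddCircle.toCircle_add, neg_smul]
  simp

lemma exists_coe_eq_abs_eq_norm (z : UnitAddCircle) : ∃ t : ℝ, (t : UnitAddCircle) = z ∧ |t| = ‖z‖ := by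
  induction z using QuotientAddGroup.induction_on with
  | H t =>
    refine ⟨t - round t, ?_, (UnitAddCircle.norm_eq).symm⟩
    rw [AddCircle.coe_sub]
    have : ((round t : ℝ) : UnitAddCircle) = 0 := by
      rw [AddCircle.coe_eq_zero_iff]
      exact ⟨round t, by simp⟩
    rw [this, sub_zero]

lemma norm_le_half (z : UnitAddCircle) : ‖z‖ ≤ 1 / 2 := by
  simpa using AddCircle.norm_le_half_period (1 : ℝ) (x := z) one_ne_zero

/-- The chord is `2 |sin πt|` for a representative with `|t| ≤ 1/2`, and Jordan's inequality
applies. -/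
lemma four_mul_norm_le_norm_fourier_sub_one {ε : ℤ} (hε : |ε| = 1) (z : UnitAddCircle) :
    4 * ‖z‖ ≤ ‖fourier ε z - 1‖ := by
  obtain ⟨t, rfl, ht⟩ := exists_coe_eq_abs_eq_norm z
  have hε' : |(ε : ℝ)| = 1 := by exact_mod_cast hε
  have h₁ : (2 * Real.pi * Complex.I * ε * t / (1 : ℝ) : ℂ)
      = Complex.I * ((2 * Real.pi * ε * t : ℝ) : ℂ) := by
    push_cast
    ring
  rw [fourier_coe_apply, h₁, Complex.norm_exp_I_mul_ofReal_sub_one, ← ht, norm_mul,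
    Real.norm_eq_abs, Real.norm_eq_abs]
  have h₂ : |2 * Real.pi * ε * t / 2| = Real.pi * |t| := by
    rw [show 2 * Real.pi * ε * t / 2 = Real.pi * (ε * t) by ring, abs_mul, abs_mul, hε',
      abs_of_pos Real.pi_pos, one_mul]
  have h₃ : |t| ≤ 1 / 2 := ht ▸ norm_le_half _
  have h₄ := Real.mul_abs_le_abs_sin (x := 2 * Real.pi * ε * t / 2) (by
    rw [h₂]
    nlinarith [Real.pi_pos])
  rw [h₂] at h₄
  have h₅ : 2 / Real.pi * (Real.pi * |t|) = 2 * |t| := by field_simp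
  rw [h₅] at h₄
  rw [abs_two]
  linarith

/-! ### Blocks of a Fourier series -/

/-- The part of the Fourier series with coefficients `b` at the frequencies `N + ε j`, `j > 0`,
weighted by the `j`-th coefficients of `σ_m`. -/
noncomputable def block (N ε : ℤ) (m : ℕ) (b : ℤ → ℂ) (x : UnitAddCircle) : ℂ :=
  ∑ j ∈ Finset.range (4 * m + 2),
    ((sigmaCoeff m j : ℂ) * b (N + ε * j)) * fourier (N + ε * j) x

lemma continuous_block (N ε : ℤ) (m : ℕ) (b : ℤ → ℂ) : Continuous (block N ε m b) := by
  unfold block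
  fun_prop

lemma lintegral_enorm_block_sq (N : ℤ) {ε : ℤ} (hε : |ε| = 1) (m : ℕ) (b : ℤ → ℂ) :
    ∫⁻ x, ‖block N ε m b x‖ₑ ^ 2 =
      ∑ j ∈ Finset.range (4 * m + 2),
        ENNReal.ofReal (sigmaCoeff m j ^ 2) * ‖b (N + ε * j)‖ₑ ^ 2 := by
  have hφ : Function.Injective fun j : ℕ => N + ε * (j : ℤ) := by
    intro j j' h
    have hε0 : ε ≠ 0 := by
      rintro rfl
      simp at hε
    have := mul_left_cancel₀ hε0 (add_left_cancel h)
    exact_mod_cast this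
  unfold block
  rw [lintegral_enorm_sq_sum_fourier _ hφ]
  refine Finset.sum_congr rfl fun j _ => ?_
  rw [enorm_mul, mul_pow, ← sq_abs, ENNReal.ofReal_pow (abs_nonneg _)]
  rw [← Real.norm_eq_abs, ← Complex.norm_real, ofReal_norm]

/-- If `b n = e^{2πiεx} c (n + ε) - c n`, then a block of `b` at `x` is controlled by `c`. -/
lemma enorm_block_sq_le (N ε : ℤ) {m : ℕ} (hm : 0 < m) {b c : ℤ → ℂ} {x : UnitAddCircle}
    (h : ∀ n, b n = fourier ε x * c (n + ε) - c n) :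
    ‖block N ε m b x‖ₑ ^ 2 ≤ ENNReal.ofReal (24 / m) *
      ∑ j ∈ Finset.range (4 * m + 2), ‖c (N + ε * (j + 1 : ℕ))‖ₑ ^ 2 := by
  have hm' : (1 : ℝ) ≤ m := by exact_mod_cast hm
  set B : ℕ → ℂ := fun j => fourier (N + ε * j) x * c (N + ε * j) with hB
  have hnB : ∀ j, ‖B j‖ = ‖c (N + ε * j)‖ := by
    intro j
    rw [hB]
    simp only [norm_mul, fourier_apply, Circle.norm_coe, one_mul]
  -- Summation by parts.
  have hstep : ∀ n : ℕ, ∑ j ∈ Finset.range n, (sigmaCoeff m j : ℂ) * (B (j + 1) - B j) =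
      (sigmaCoeff m n : ℂ) * B n +
        ∑ j ∈ Finset.range n, ((sigmaCoeff m j - sigmaCoeff m (j + 1) : ℝ) : ℂ) * B (j + 1) := by
    intro n
    induction n with
    | zero => simp [sigmaCoeff_zero]
    | succ n ih =>
      rw [Finset.sum_range_succ, Finset.sum_range_succ, ih]
      push_cast
      ring
  have hblock : block N ε m b x = ∑ j ∈ Finset.range (4 * m + 2),
      ((sigmaCoeff m j - sigmaCoeff m (j + 1) : ℝ) : ℂ) * B (j + 1) := by
    have h0 : sigmaCoeff m ((4 * m + 2 : ℕ) : ℤ) = 0 := by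
      exact_mod_cast sigmaCoeff_four_mul_add_two m
    have := hstep (4 * m + 2)
    rw [h0, Complex.ofReal_zero, zero_mul, zero_add] at this
    rw [← this]
    refine Finset.sum_congr rfl fun j _ => ?_
    have e : N + ε * ((j + 1 : ℕ) : ℤ) = N + ε * j + ε := by push_cast; ring
    rw [h, hB]
    simp only [e]
    rw [fourier_add (m := N + ε * j)]
    ring
  have hnorm : ‖block N ε m b x‖ ≤
      2 / m * ∑ j ∈ Finset.range (4 * m + 2), ‖c (N + ε * (j + 1 : ℕ))‖ := by
    rw [hblock, Finset.mul_sum]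
    refine (norm_sum_le _ _).trans (Finset.sum_le_sum fun j _ => ?_)
    rw [norm_mul, hnB, Complex.norm_real, Real.norm_eq_abs]
    gcongr
    exact abs_sigmaCoeff_sub_le hm j
  have hsq : ‖block N ε m b x‖ ^ 2 ≤
      24 / m * ∑ j ∈ Finset.range (4 * m + 2), ‖c (N + ε * (j + 1 : ℕ))‖ ^ 2 := by
    calc ‖block N ε m b x‖ ^ 2
        ≤ (2 / m * ∑ j ∈ Finset.range (4 * m + 2), ‖c (N + ε * (j + 1 : ℕ))‖) ^ 2 := by gcongr
      _ = (2 / m) ^ 2 * (∑ j ∈ Finset.range (4 * m + 2), ‖c (N + ε * (j + 1 : ℕ))‖) ^ 2 := by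
          rw [mul_pow]
      _ ≤ (2 / m) ^ 2 * (((4 * m + 2 : ℕ) : ℝ) *
            ∑ j ∈ Finset.range (4 * m + 2), ‖c (N + ε * (j + 1 : ℕ))‖ ^ 2) := by
          gcongr
          simpa using sq_sum_le_card_mul_sum_sq (s := Finset.range (4 * m + 2))
            (f := fun j => ‖c (N + ε * (j + 1 : ℕ))‖)
      -- `4m + 2 ≤ 6m` since `m ≥ 1`; this produces `24 / m`.
      _ ≤ (2 / m) ^ 2 * (6 * m *
            ∑ j ∈ Finset.range (4 * m + 2), ‖c (N + ε * (j + 1 : ℕ))‖ ^ 2) := by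
          gcongr
          push_cast
          linarith
      _ = _ := by
          field_simp
          ring
  have := ENNReal.ofReal_le_ofReal hsq
  rw [ENNReal.ofReal_mul (by positivity), ENNReal.ofReal_sum_of_nonneg (fun _ _ => by positivity)]
    at this
  simpa only [ENNReal.ofReal_pow (norm_nonneg _), ofReal_norm] using this

/-- Division of a function which vanishes near `x` by `e^{2πiε(x-y)} - 1`. -/
lemma exists_fourierCoeff_eq_sub {ε : ℤ} (hε : |ε| = 1) {f : UnitAddCircle → ℂ}
    (hf : MemLp f 2 volume) {x : UnitAddCircle} {d : ℝ} (hd : 0 < d)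
    (hx : ∀ y, ‖x - y‖ < d → f y = 0) :
    ∃ g : UnitAddCircle → ℂ, MemLp g 2 volume ∧
      (∀ n, fourierCoeff f n = fourier ε x * fourierCoeff g (n + ε) - fourierCoeff g n) ∧
      ∀ y, ‖g y‖ ≤ ‖f y‖ * (1 / (4 * ‖x - y‖)) := by
  -- At `y = x` the inverse takes the default value 0, which is harmless since `f` vanishes there.
  set g : UnitAddCircle → ℂ := fun y => f y * (fourier ε (x - y) - 1)⁻¹ with hg
  have hgb : ∀ y, ‖g y‖ ≤ ‖f y‖ * (1 / (4 * ‖x - y‖)) := by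
    intro y
    by_cases hy : ‖x - y‖ < d
    · simp [hg, hx y hy]
    · have : 0 < ‖x - y‖ := hd.trans_le (not_lt.1 hy)
      rw [hg]
      simp only [norm_mul, norm_inv]
      rw [← one_div]
      gcongr
      exact four_mul_norm_le_norm_fourier_sub_one hε _
  have hgm : MemLp g 2 volume := by
    refine hf.of_le_mul (c := 1 / (4 * d)) ?_ (Filter.Eventually.of_forall fun y => ?_)
    · refine hf.aestronglyMeasurable.mul ?_
      have : Measurable fun y : UnitAddCircle => (fourier ε (x - y) - 1 : ℂ) :=
        (by fun_prop : Continuous fun y : UnitAddCircle => (fourier ε (x - y) - 1 : ℂ)).measurable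
      exact this.inv.aestronglyMeasurable
    · by_cases hy : ‖x - y‖ < d
      · simp [hg, hx y hy]
      · rw [mul_comm]
        refine (hgb y).trans ?_
        gcongr
        exact not_lt.1 hy
  refine ⟨g, hgm, fun n => ?_, hgb⟩
  have hfg : ∀ y, f y = fourier ε (x - y) * g y - g y := by
    intro y
    by_cases hy : ‖x - y‖ < d
    · simp [hg, hx y hy]
    · have h0 : (fourier ε (x - y) - 1 : ℂ) ≠ 0 := by
        intro h0
        have := four_mul_norm_le_norm_fourier_sub_one hε (x - y)
        rw [h0, norm_zero] at this
        linarith [not_lt.1 hy]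
      rw [hg]
      field_simp
  have hgi : Integrable g AddCircle.haarAddCircle :=
    volume_eq_haarAddCircle ▸ hgm.integrable one_le_two
  have hsplit : ∀ y, fourier (-n) y • f y =
      fourier ε x * (fourier (-(n + ε)) y • g y) - fourier (-n) y • g y := by
    intro y
    rw [hfg y, fourier_sub_apply, neg_add, fourier_add]
    simp only [smul_eq_mul]
    ring
  unfold fourierCoeff
  simp_rw [hsplit]
  rw [integral_sub ((hgi.fourier_smul _).const_mul _) (hgi.fourier_smul _),
    integral_const_mul]

/-! ### Square functions of blocks over separated frequencies -/

/-- The square function `∑_k ∑_i |block|²`, over the dyadic scales `2 ^ i` with `s⁻¹ < 2 ^ i` and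
`i ≤ L k`. -/
noncomputable def blockSquare {ι : Type*} (N : ι → ℤ) (L : ι → ℕ) (ε : ℤ) (b : ℤ → ℂ) (s : ℝ)
    (x : UnitAddCircle) : ℝ≥0∞ :=
  ∑' k, ∑' i : ℕ, if i ≤ L k ∧ s⁻¹ < 2 ^ i then ‖block (N k) ε (2 ^ i) b x‖ₑ ^ 2 else 0

/-- The frequencies `N k + ε j`, `1 ≤ j ≤ 6 · 2 ^ L k`, are distinct for distinct `k`. -/
def SeparatedFreq {ι : Type*} (N : ι → ℤ) (L : ι → ℕ) (ε : ℤ) : Prop :=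
  ∀ k k' (j j' : ℕ), 1 ≤ j → j ≤ 6 * 2 ^ L k → 1 ≤ j' → j' ≤ 6 * 2 ^ L k' →
    N k + ε * j = N k' + ε * j' → k = k'

section Square

variable {ι : Type*} {N : ι → ℤ} {L : ι → ℕ} {ε : ℤ}

/-- The map `(k, j) ↦ N k + ε j` is injective on the admissible pairs, so each integer is counted at
most once. -/
lemma SeparatedFreq.tsum_le (hsep : SeparatedFreq N L ε) (hε : |ε| = 1) (c : ℤ → ℝ≥0∞) :
    ∑' k, ∑' j : ℕ, (if 1 ≤ j ∧ j ≤ 6 * 2 ^ L k then c (N k + ε * j) else 0) ≤ ∑' n, c n := by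
  have hε0 : ε ≠ 0 := by
    rintro rfl
    simp at hε
  set S : Set (ι × ℕ) := {p | 1 ≤ p.2 ∧ p.2 ≤ 6 * 2 ^ L p.1} with hS
  have hinj : Function.Injective fun p : S => N p.1.1 + ε * (p.1.2 : ℤ) := by
    rintro ⟨⟨k, j⟩, h₁, h₂⟩ ⟨⟨k', j'⟩, h₁', h₂'⟩ h
    obtain rfl := hsep k k' j j' h₁ h₂ h₁' h₂' h
    have := mul_left_cancel₀ hε0 (add_left_cancel h)
    have : j = j' := by exact_mod_cast this
    subst this
    rfl
  calc ∑' k, ∑' j : ℕ, (if 1 ≤ j ∧ j ≤ 6 * 2 ^ L k then c (N k + ε * j) else 0)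
      = ∑' p : ι × ℕ, S.indicator (fun p => c (N p.1 + ε * p.2)) p := by
        rw [ENNReal.tsum_prod']
        refine tsum_congr fun k => tsum_congr fun j => ?_
        simp [indicator, hS]
    _ = ∑' p : S, c (N p.1.1 + ε * p.1.2) := (tsum_subtype S _).symm
    _ ≤ ∑' n, c n := ENNReal.tsum_comp_le_tsum_of_injective hinj c

lemma measurable_ite_enorm_block (k : ι) (i : ℕ) (b : ℤ → ℂ) (s : ℝ) : Measurable fun x =>
    if i ≤ L k ∧ s⁻¹ < 2 ^ i then ‖block (N k) ε (2 ^ i) b x‖ₑ ^ 2 else 0 := by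
  split_ifs
  · exact (continuous_block _ _ _ _).measurable.enorm.pow_const 2
  · exact measurable_const

lemma measurable_blockSquare [Countable ι] (b : ℤ → ℂ) (s : ℝ) :
    Measurable (blockSquare N L ε b s) :=
  Measurable.tsum fun k => Measurable.tsum fun i => measurable_ite_enorm_block k i b s

/-- Parseval for each block. Overlapping scales at one anchor cost nothing because `∑ σ² ≤ 1`, and
different anchors use different frequencies. -/
lemma lintegral_blockSquare_le [Countable ι] (hsep : SeparatedFreq N L ε) (hε : |ε| = 1)
    (b : ℤ → ℂ) (s : ℝ) :
    ∫⁻ x, blockSquare N L ε b s x ≤ ∑' n, ‖b n‖ₑ ^ 2 := by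
  unfold blockSquare
  rw [lintegral_tsum fun k => (Measurable.tsum fun i => measurable_ite_enorm_block k i b s).aemeasurable]
  refine le_trans (ENNReal.tsum_le_tsum fun k => ?_)
    (hsep.tsum_le hε fun n => ‖b n‖ₑ ^ 2)
  rw [lintegral_tsum fun i => (measurable_ite_enorm_block k i b s).aemeasurable]
  calc ∑' i : ℕ, ∫⁻ x, (if i ≤ L k ∧ s⁻¹ < 2 ^ i then ‖block (N k) ε (2 ^ i) b x‖ₑ ^ 2 else 0)
      ≤ ∑' i : ℕ, ∑' j : ℕ, ENNReal.ofReal (sigmaCoeff (2 ^ i) j ^ 2) *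
          (if 1 ≤ j ∧ j ≤ 6 * 2 ^ L k then ‖b (N k + ε * j)‖ₑ ^ 2 else 0) := by
        refine ENNReal.tsum_le_tsum fun i => ?_
        split_ifs with hi
        · rw [lintegral_enorm_block_sq _ hε]
          refine le_trans (Finset.sum_le_sum fun j hj => ?_) (ENNReal.sum_le_tsum _)
          rcases Nat.eq_zero_or_pos j with rfl | hj0
          · simp [sigmaCoeff_zero]
          · have h1 : 2 ^ i ≤ 2 ^ L k := Nat.pow_le_pow_right two_pos hi.1
            have h2 : 1 ≤ 2 ^ i := Nat.one_le_two_pow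
            rw [Finset.mem_range] at hj
            rw [if_pos ⟨hj0, by omega⟩]
        · simp
    _ = ∑' j : ℕ, (∑' i : ℕ, ENNReal.ofReal (sigmaCoeff (2 ^ i) j ^ 2)) *
          (if 1 ≤ j ∧ j ≤ 6 * 2 ^ L k then ‖b (N k + ε * j)‖ₑ ^ 2 else 0) := by
        rw [ENNReal.tsum_comm]
        simp_rw [ENNReal.tsum_mul_right]
    _ ≤ _ := by
        refine ENNReal.tsum_le_tsum fun j => ?_
        refine (mul_le_mul_left (tsum_sigmaCoeff_sq_le_one j) _).trans ?_
        rw [one_mul]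

lemma tsum_ofReal_geometric_two {c : ℝ} (hc : 0 ≤ c) :
    ∑' i : ℕ, ENNReal.ofReal (c * (1 / 2) ^ i) = ENNReal.ofReal (c * 2) := by
  have hgeom : HasSum (fun i : ℕ => c * (1 / 2) ^ i) (c * 2) := hasSum_geometric_two.mul_left _
  rw [← hgeom.tsum_eq, ENNReal.ofReal_tsum_of_nonneg (fun _ => by positivity) hgeom.summable]

lemma tsum_dyadic_le {s : ℝ} (hs : 0 < s) :
    ∑' i : ℕ, (if s⁻¹ < 2 ^ i then ENNReal.ofReal (24 / ((2 ^ i : ℕ) : ℝ)) else 0) ≤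
      ENNReal.ofReal (48 * s) := by
  obtain ⟨n₀, h₀, hmin⟩ : ∃ n : ℕ, s⁻¹ < (2 : ℝ) ^ n ∧ ∀ i < n, ¬ s⁻¹ < (2 : ℝ) ^ i := by
    classical
    have hex : ∃ n : ℕ, s⁻¹ < (2 : ℝ) ^ n := pow_unbounded_of_one_lt s⁻¹ one_lt_two
    exact ⟨Nat.find hex, Nat.find_spec hex, fun i hi => Nat.find_min hex hi⟩
  set F : ℕ → ℝ≥0∞ := fun i =>
    if s⁻¹ < 2 ^ i then ENNReal.ofReal (24 / ((2 ^ i : ℕ) : ℝ)) else 0 with hF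
  have h₁ : ∀ i : ℕ, F (i + n₀) ≤ ENNReal.ofReal (24 * s * (1 / 2) ^ i) := by
    intro i
    rw [hF]
    dsimp only
    split_ifs
    · apply ENNReal.ofReal_le_ofReal
      have h₂ : ((2 : ℝ) ^ n₀)⁻¹ ≤ s := inv_le_of_inv_le₀ hs h₀.le
      calc 24 / ((2 ^ (i + n₀) : ℕ) : ℝ) = 24 * ((2 : ℝ) ^ n₀)⁻¹ * (1 / 2) ^ i := by
            push_cast
            rw [pow_add, one_div, inv_pow]
            field_simp
        _ ≤ 24 * s * (1 / 2) ^ i := by gcongr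
    · exact zero_le
  have h₂ : ∑ i ∈ Finset.range n₀, F i = 0 :=
    Finset.sum_eq_zero fun i hi => if_neg (hmin i (Finset.mem_range.1 hi))
  calc ∑' i, F i = ∑ i ∈ Finset.range n₀, F i + ∑' i, F (i + n₀) :=
        (Summable.sum_add_tsum_nat_add' (f := F) ENNReal.summable).symm
    _ ≤ ∑' i : ℕ, ENNReal.ofReal (24 * s * (1 / 2) ^ i) := by
        rw [h₂, zero_add]
        exact ENNReal.tsum_le_tsum h₁
    _ = ENNReal.ofReal (24 * s * 2) := tsum_ofReal_geometric_two (by positivity)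
    _ = ENNReal.ofReal (48 * s) := by
        congr 1
        ring

/-- The square function of a function that vanishes near `x`. -/
lemma blockSquare_le_of_eq_zero (hsep : SeparatedFreq N L ε) (hε : |ε| = 1)
    {f : UnitAddCircle → ℂ} (hf : MemLp f 2 volume) {x : UnitAddCircle} {d s : ℝ} (hd : 0 < d)
    (hs : 0 < s) (hx : ∀ y, ‖x - y‖ < d → f y = 0) :
    blockSquare N L ε (fourierCoeff f) s x ≤
      ENNReal.ofReal (48 * s) * ∫⁻ y, ‖f y‖ₑ ^ 2 * ENNReal.ofReal ((1 / (4 * ‖x - y‖)) ^ 2) := by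
  obtain ⟨g, hg, hfg, hgb⟩ := exists_fourierCoeff_eq_sub hε hf hd hx
  have hg2 : ∑' n, ‖fourierCoeff g n‖ₑ ^ 2 ≤
      ∫⁻ y, ‖f y‖ₑ ^ 2 * ENNReal.ofReal ((1 / (4 * ‖x - y‖)) ^ 2) := by
    rw [tsum_enorm_fourierCoeff_sq hg]
    refine lintegral_mono fun y => ?_
    have := ENNReal.ofReal_le_ofReal (pow_le_pow_left₀ (norm_nonneg _) (hgb y) 2)
    rw [mul_pow, ENNReal.ofReal_mul (by positivity), ENNReal.ofReal_pow (norm_nonneg _),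
      ENNReal.ofReal_pow (norm_nonneg _), ofReal_norm, ofReal_norm] at this
    exact this
  refine le_trans ?_ (mul_le_mul' (tsum_dyadic_le hs) hg2)
  unfold blockSquare
  rw [ENNReal.tsum_comm, ← ENNReal.tsum_mul_right]
  refine ENNReal.tsum_le_tsum fun i => ?_
  split_ifs with hi
  · refine le_trans ?_ (mul_le_mul_right (hsep.tsum_le hε fun n => ‖fourierCoeff g n‖ₑ ^ 2) _)
    rw [← ENNReal.tsum_mul_left]
    refine ENNReal.tsum_le_tsum fun k => ?_
    split_ifs with hk
    · refine (enorm_block_sq_le (N k) ε (by positivity) hfg).trans ?_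
      gcongr
      have h1 : 2 ^ i ≤ 2 ^ L k := Nat.pow_le_pow_right two_pos hk.1
      have h2 : 1 ≤ 2 ^ i := Nat.one_le_two_pow
      set c : ℕ → ℝ≥0∞ := fun j =>
        if 1 ≤ j ∧ j ≤ 6 * 2 ^ L k then ‖fourierCoeff g (N k + ε * j)‖ₑ ^ 2 else 0 with hc
      calc ∑ j ∈ Finset.range (4 * 2 ^ i + 2), ‖fourierCoeff g (N k + ε * (j + 1 : ℕ))‖ₑ ^ 2
          = ∑ j ∈ Finset.range (4 * 2 ^ i + 2), c (j + 1) := by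
            refine Finset.sum_congr rfl fun j hj => ?_
            rw [Finset.mem_range] at hj
            rw [hc]
            simp only
            -- The shifted index reaches `4 * 2 ^ i + 2`, which equals `6 * 2 ^ L k` when `i = L k =
            -- 0`: the separated range has to include its upper end.
            rw [if_pos ⟨by omega, by omega⟩]
        _ ≤ ∑' j, c (j + 1) := ENNReal.sum_le_tsum _
        _ ≤ ∑' j, c j := ENNReal.tsum_comp_le_tsum_of_injective (add_left_injective 1) c
    · exact zero_le
  · rw [zero_mul, nonpos_iff_eq_zero]
    exact ENNReal.tsum_eq_zero.2 fun k => if_neg fun h => hi h.2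

lemma enorm_add_sq_le (a b : ℂ) : ‖a + b‖ₑ ^ 2 ≤ 2 * (‖a‖ₑ ^ 2 + ‖b‖ₑ ^ 2) := by
  have h : ‖a + b‖ ^ 2 ≤ 2 * (‖a‖ ^ 2 + ‖b‖ ^ 2) := by
    nlinarith [norm_add_le a b, norm_nonneg (a + b), sq_nonneg (‖a‖ - ‖b‖)]
  have := ENNReal.ofReal_le_ofReal h
  rw [ENNReal.ofReal_mul zero_le_two, ENNReal.ofReal_add (sq_nonneg _) (sq_nonneg _),
    ENNReal.ofReal_pow (norm_nonneg _), ENNReal.ofReal_pow (norm_nonneg _),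
    ENNReal.ofReal_pow (norm_nonneg _), ofReal_norm, ofReal_norm, ofReal_norm] at this
  simpa using this

lemma block_congr (N : ℤ) {ε : ℤ} {m : ℕ} {b c : ℤ → ℂ}
    (h : ∀ j : ℕ, 1 ≤ j → j ≤ 4 * m + 1 → b (N + ε * j) = c (N + ε * j)) (x : UnitAddCircle) :
    block N ε m b x = block N ε m c x := by
  refine Finset.sum_congr rfl fun j hj => ?_
  rcases Nat.eq_zero_or_pos j with rfl | hj0
  · simp [sigmaCoeff_zero]
  · rw [Finset.mem_range] at hj
    rw [h j hj0 (by omega)]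

lemma block_add (N ε : ℤ) (m : ℕ) (b c : ℤ → ℂ) (x : UnitAddCircle) :
    block N ε m (b + c) x = block N ε m b x + block N ε m c x := by
  unfold block
  rw [← Finset.sum_add_distrib]
  refine Finset.sum_congr rfl fun j _ => ?_
  simp only [Pi.add_apply]
  ring

/-- The zero frequency enters no block, so the splitting may ignore an additive constant in the
function. -/
lemma blockSquare_le_two_mul_add {a b c : ℤ → ℂ} (h : ∀ n ≠ 0, a n = b n + c n)
    (h0 : ∀ k (j : ℕ), 1 ≤ j → j < 6 * 2 ^ L k → N k + ε * j ≠ 0) (s : ℝ) (x : UnitAddCircle) :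
    blockSquare N L ε a s x ≤ 2 * (blockSquare N L ε b s x + blockSquare N L ε c s x) := by
  unfold blockSquare
  rw [← ENNReal.tsum_add, ← ENNReal.tsum_mul_left]
  refine ENNReal.tsum_le_tsum fun k => ?_
  rw [← ENNReal.tsum_add, ← ENNReal.tsum_mul_left]
  refine ENNReal.tsum_le_tsum fun i => ?_
  split_ifs with hi
  · rw [block_congr (N k) (c := b + c), block_add]
    · exact enorm_add_sq_le _ _
    · intro j hj hj'
      have h1 : 2 ^ i ≤ 2 ^ L k := Nat.pow_le_pow_right two_pos hi.1
      have h2 : 1 ≤ 2 ^ i := Nat.one_le_two_pow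
      exact h _ (h0 k j hj (by omega))
  · simp

end Square

/-! ### The projections on Whitney intervals are blocks -/

lemma sum_Icc_one_eq_sum_range {M : Type*} [AddCommMonoid M] (n : ℕ) {F : ℤ → M} (h : F 0 = 0) :
    ∑ j ∈ Finset.Icc (1 : ℤ) n, F j = ∑ j ∈ Finset.range (n + 1), F j := by
  rw [Finset.sum_range_succ']
  simp only [Nat.cast_zero, h, add_zero]
  symm
  refine Finset.sum_nbij (fun j : ℕ => (j + 1 : ℤ)) ?_ ?_ ?_ ?_
  · intro j hj
    rw [Finset.mem_range] at hj
    rw [Finset.mem_Icc]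
    omega
  · intro j _ j' _ hjj'
    simpa using hjj'
  · intro j hj
    rw [Finset.coe_Icc, mem_Icc] at hj
    refine ⟨(j - 1).toNat, ?_, ?_⟩
    · rw [Finset.coe_range, mem_Iio]
      omega
    · simp only
      omega
  · intro j _
    push_cast
    rfl

lemma sum_Icc_neg_eq_sum_range {M : Type*} [AddCommMonoid M] (n : ℕ) {F : ℤ → M} (h : F 0 = 0) :
    ∑ j ∈ Finset.Icc (-n : ℤ) (-1), F j = ∑ j ∈ Finset.range (n + 1), F (-j) := by
  rw [← sum_Icc_one_eq_sum_range n (F := fun j => F (-j)) (by simpa using h)]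
  refine Finset.sum_nbij (fun j : ℤ => -j) ?_ ?_ ?_ ?_
  · intro j hj
    rw [Finset.mem_Icc] at hj ⊢
    omega
  · intro j _ j' _ hjj'
    simpa using hjj'
  · intro j hj
    rw [Finset.coe_Icc, mem_Icc] at hj
    refine ⟨-j, ?_, by simp⟩
    rw [Finset.coe_Icc, mem_Icc]
    omega
  · intro j _
    simp

lemma conv_eq_block {D u : UnitAddCircle → ℂ} (hu : Integrable u) (N ε : ℤ) (m : ℕ)
    (hD : ∀ z, D z = ∑ j ∈ Finset.range (4 * m + 2),
      (sigmaCoeff m j : ℂ) * fourier (N + ε * j) z) (x : UnitAddCircle) :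
    conv D u x = block N ε m (fourierCoeff u) x := by
  have hu' : Integrable u AddCircle.haarAddCircle := volume_eq_haarAddCircle ▸ hu
  have h : ∀ y, D (x - y) * u y = ∑ j ∈ Finset.range (4 * m + 2),
      ((sigmaCoeff m j : ℂ) * fourier (N + ε * j) x) * (fourier (-(N + ε * j)) y • u y) := by
    intro y
    rw [hD, Finset.sum_mul]
    refine Finset.sum_congr rfl fun j _ => ?_
    rw [fourier_sub_apply, smul_eq_mul]
    ring
  unfold conv block
  simp_rw [h]
  rw [volume_eq_haarAddCircle]
  rw [integral_finsetSum _ fun j _ => (hu'.fourier_smul _).const_mul _]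
  refine Finset.sum_congr rfl fun j _ => ?_
  rw [integral_const_mul, fourierCoeff]
  ring

lemma conv_deltaLeft {u : UnitAddCircle → ℂ} (hu : Integrable u) {J : Set ℝ} {a : ℤ} {m : ℕ}
    (hl : len J = m) (hs : sSup J = a + 2 * m) (x : UnitAddCircle) :
    conv (deltaLeft J) u x = block a 1 m (fourierCoeff u) x := by
  have h₁ : ⌊sSup J⌋ - 2 * ⌊len J⌋ = a := by
    rw [hs, hl, show (a : ℝ) + 2 * m = ((a + 2 * m : ℤ) : ℝ) by push_cast; rfl, Int.floor_intCast,
      Int.floor_natCast]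
    ring
  refine conv_eq_block hu a 1 m (fun z => ?_) x
  unfold deltaLeft sigmaPos
  rw [h₁, hl, Nat.floor_natCast, Finset.mul_sum]
  have := sum_Icc_one_eq_sum_range (4 * m + 1)
    (F := fun j : ℤ => (fourier a z : ℂ) * ((sigmaCoeff m j : ℂ) * fourier j z))
    (by simp [sigmaCoeff_zero])
  push_cast at this
  rw [this]
  refine Finset.sum_congr rfl fun j _ => ?_
  rw [one_mul, fourier_add]
  ring

lemma conv_deltaRight {u : UnitAddCircle → ℂ} (hu : Integrable u) {J : Set ℝ} {b : ℤ} {m : ℕ}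
    (hl : len J = m) (hs : sInf J = b - 2 * m) (x : UnitAddCircle) :
    conv (deltaRight J) u x = block b (-1) m (fourierCoeff u) x := by
  have h₁ : ⌊sInf J⌋ + 2 * ⌊len J⌋ = b := by
    rw [hs, hl, show (b : ℝ) - 2 * m = ((b - 2 * m : ℤ) : ℝ) by push_cast; rfl, Int.floor_intCast,
      Int.floor_natCast]
    ring
  refine conv_eq_block hu b (-1) m (fun z => ?_) x
  unfold deltaRight sigmaNeg
  rw [h₁, hl, Nat.floor_natCast, Finset.mul_sum]
  have := sum_Icc_neg_eq_sum_range (4 * m + 1)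
    (F := fun j : ℤ => (fourier b z : ℂ) * ((sigmaCoeff m j : ℂ) * fourier j z))
    (by simp [sigmaCoeff_zero])
  push_cast at this
  rw [this]
  refine Finset.sum_congr rfl fun j _ => ?_
  rw [neg_one_mul, fourier_add, sigmaCoeff_neg]
  ring

section Whitney

variable {K : Set ℝ} {a : ℤ} {n : ℕ}

lemma Ioo_subset_of_isGLB_of_isLUB {α β : ℝ} (hK : K.OrdConnected) (ha : IsGLB K α)
    (hb : IsLUB K β) : Ioo α β ⊆ K := by
  intro p hp
  obtain ⟨x, hx, hxp⟩ := (isGLB_lt_iff ha).1 hp.1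
  obtain ⟨y, hy, hyp⟩ := (lt_isLUB_iff hb).1 hp.2
  exact hK.out hx hy ⟨hxp.le, hyp.le⟩

lemma whitneyLeft_eq (ha : IsGLB K (a : ℝ)) (hb : IsLUB K ((a : ℝ) + 3 * 2 ^ (n + 1))) (l : ℕ) :
    whitneyLeft K l = Ico ((a : ℝ) + 2 ^ n / 2 ^ l) (a + 2 * (2 ^ n / 2 ^ l)) := by
  have hne : K.Nonempty := ha.nonempty
  have h : len K = 6 * 2 ^ n := by
    rw [len, ha.csInf_eq hne, hb.csSup_eq hne]
    ring
  rw [whitneyLeft, h, ha.csInf_eq hne]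
  congr 1
  · rw [inv_pow, pow_succ]
    field_simp
    ring
  · rw [inv_pow]
    field_simp
    ring

lemma whitneyRight_eq (ha : IsGLB K (a : ℝ)) (hb : IsLUB K ((a : ℝ) + 3 * 2 ^ (n + 1))) (l : ℕ) :
    whitneyRight K l = Ioc ((a : ℝ) + 3 * 2 ^ (n + 1) - 2 * (2 ^ n / 2 ^ l))
      (a + 3 * 2 ^ (n + 1) - 2 ^ n / 2 ^ l) := by
  have hne : K.Nonempty := ha.nonempty
  have h : len K = 6 * 2 ^ n := by
    rw [len, ha.csInf_eq hne, hb.csSup_eq hne]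
    ring
  rw [whitneyRight, h, hb.csSup_eq hne]
  congr 1
  · rw [inv_pow]
    field_simp
    ring
  · rw [inv_pow, pow_succ]
    field_simp
    ring

/-- `s⁻¹ ≥ 1`, so only Whitney intervals with integer length and endpoints occur, and the floors in
the kernels are exact. -/
lemma le_of_inv_lt_two_pow_div {s : ℝ} (hs : 0 < s) (hs1 : s ≤ 1) {l : ℕ}
    (h : s⁻¹ < 2 ^ n / 2 ^ l) : l ≤ n := by
  have h₁ : (1 : ℝ) < 2 ^ n / 2 ^ l := (one_le_inv₀ hs).2 hs1 |>.trans_lt h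
  rw [one_lt_div (by positivity)] at h₁
  exact ((pow_lt_pow_iff_right₀ one_lt_two).1 h₁).le

lemma two_pow_div_two_pow {l : ℕ} (h : l ≤ n) :
    (2 : ℝ) ^ n / 2 ^ l = ((2 ^ (n - l) : ℕ) : ℝ) := by
  push_cast
  rw [pow_sub₀ _ two_ne_zero h, div_eq_mul_inv]

lemma tsum_whitney_le {s : ℝ} (hs : 0 < s) (hs1 : s ≤ 1) {p : ℕ → ℝ}
    (hp : ∀ l, p l = 2 ^ n / 2 ^ l) {F G : ℕ → ℝ≥0∞}
    (hFG : ∀ l ≤ n, F l = G (n - l)) :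
    ∑' l : {l : ℕ // s⁻¹ < p l}, F l ≤
      ∑' i : ℕ, if i ≤ n ∧ s⁻¹ < 2 ^ i then G i else 0 := by
  have hle : ∀ l : {l : ℕ // s⁻¹ < p l}, l.1 ≤ n := fun l =>
    le_of_inv_lt_two_pow_div hs hs1 (hp l ▸ l.2)
  have hinj : Function.Injective fun l : {l : ℕ // s⁻¹ < p l} => n - l.1 := by
    intro l l' h
    have h₁ := hle l
    have h₂ := hle l'
    simp only at h
    exact Subtype.ext (by omega)
  refine le_trans (le_of_eq (tsum_congr fun l => ?_)) (ENNReal.tsum_comp_le_tsum_of_injective hinj _)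
  have h := l.2
  rw [hp, two_pow_div_two_pow (hle l)] at h
  rw [if_pos ⟨Nat.sub_le _ _, by exact_mod_cast h⟩, hFG _ (hle l)]

end Whitney

/-- The square function over a family of disjoint intervals is a sum of two square functions of
blocks, anchored at the left and at the right endpoints. -/
lemma squareFun_le {𝒦 : Set (Set ℝ)} {a : 𝒦 → ℤ} {L : 𝒦 → ℕ}
    (ha : ∀ K : 𝒦, IsGLB K.1 (a K : ℝ)) (hb : ∀ K : 𝒦, IsLUB K.1 ((a K : ℝ) + 3 * 2 ^ (L K + 1)))
    {u : UnitAddCircle → ℂ} (hu : Integrable u) {s : ℝ} (hs : 0 < s) (hs1 : s ≤ 1)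
    (x : UnitAddCircle) :
    squareFun 𝒦 u s x ≤ blockSquare a L 1 (fourierCoeff u) s x +
      blockSquare (fun K => a K + 3 * 2 ^ (L K + 1)) L (-1) (fourierCoeff u) s x := by
  unfold squareFun blockSquare
  rw [← ENNReal.tsum_add]
  refine ENNReal.tsum_le_tsum fun K => add_le_add ?_ ?_
  · have hlen : ∀ l, len (whitneyLeft K l) = 2 ^ L K / 2 ^ l := by
      intro l
      have : (a K : ℝ) + 2 ^ L K / 2 ^ l < a K + 2 * (2 ^ L K / 2 ^ l) := by
        have : (0 : ℝ) < 2 ^ L K / 2 ^ l := by positivity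
        linarith
      rw [len, whitneyLeft_eq (ha K) (hb K), csSup_Ico this, csInf_Ico this]
      ring
    refine tsum_whitney_le hs hs1 hlen
      (F := fun l => ‖conv (deltaLeft (whitneyLeft K l)) u x‖ₑ ^ 2)
      (G := fun i => ‖block (a K) 1 (2 ^ i) (fourierCoeff u) x‖ₑ ^ 2) fun l hl => ?_
    have h : (0 : ℝ) < 2 ^ L K / 2 ^ l := by positivity
    rw [conv_deltaLeft hu (a := a K) (m := 2 ^ (L K - l))]
    · rw [hlen, two_pow_div_two_pow hl]
    · rw [whitneyLeft_eq (ha K) (hb K), csSup_Ico (by linarith), two_pow_div_two_pow hl]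
  · have hlen : ∀ l, len (whitneyRight K l) = 2 ^ L K / 2 ^ l := by
      intro l
      have : (a K : ℝ) + 3 * 2 ^ (L K + 1) - 2 * (2 ^ L K / 2 ^ l) <
          a K + 3 * 2 ^ (L K + 1) - 2 ^ L K / 2 ^ l := by
        have : (0 : ℝ) < 2 ^ L K / 2 ^ l := by positivity
        linarith
      rw [len, whitneyRight_eq (ha K) (hb K), csSup_Ioc this, csInf_Ioc this]
      ring
    refine tsum_whitney_le hs hs1 hlen
      (F := fun l => ‖conv (deltaRight (whitneyRight K l)) u x‖ₑ ^ 2)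
      (G := fun i => ‖block (a K + 3 * 2 ^ (L K + 1)) (-1) (2 ^ i) (fourierCoeff u) x‖ₑ ^ 2)
      fun l hl => ?_
    have h : (0 : ℝ) < 2 ^ L K / 2 ^ l := by positivity
    rw [conv_deltaRight hu (b := a K + 3 * 2 ^ (L K + 1)) (m := 2 ^ (L K - l))]
    · rw [hlen, two_pow_div_two_pow hl]
    · rw [whitneyRight_eq (ha K) (hb K), csInf_Ioc (by linarith), two_pow_div_two_pow hl]
      push_cast
      ring

/-! ### Disjointness of the intervals as separation of frequencies -/

section Disjoint

variable {𝒦 : Set (Set ℝ)} {a : 𝒦 → ℤ} {L : 𝒦 → ℕ}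

lemma Ioo_subset_of_endpoints (hc : ∀ K : 𝒦, K.1.OrdConnected)
    (ha : ∀ K : 𝒦, IsGLB K.1 (a K : ℝ)) (hb : ∀ K : 𝒦, IsLUB K.1 ((a K : ℝ) + 3 * 2 ^ (L K + 1)))
    (K : 𝒦) : Ioo (a K : ℝ) ((a K : ℝ) + 6 * 2 ^ L K) ⊆ K.1 := by
  have h := Ioo_subset_of_isGLB_of_isLUB (hc K) (ha K) (hb K)
  rwa [show (3 : ℝ) * 2 ^ (L K + 1) = 6 * 2 ^ L K by ring] at h

lemma separatedFreq_left (hd : 𝒦.PairwiseDisjoint id)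
    (h : ∀ K : 𝒦, Ioo (a K : ℝ) ((a K : ℝ) + 6 * 2 ^ L K) ⊆ K.1) : SeparatedFreq a L 1 := by
  intro K K' j j' hj₁ hj₂ hj₁' hj₂' he
  have hj₁ : (1 : ℝ) ≤ j := by exact_mod_cast hj₁
  have hj₂ : (j : ℝ) ≤ 6 * 2 ^ L K := by exact_mod_cast hj₂
  have hj₁' : (1 : ℝ) ≤ j' := by exact_mod_cast hj₁'
  have hj₂' : (j' : ℝ) ≤ 6 * 2 ^ L K' := by exact_mod_cast hj₂'
  have he : (a K : ℝ) + 1 * j = a K' + 1 * j' := by exact_mod_cast he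
  -- The shift by `1/2` gives an interior point even when `j = |K|`, whether or not the endpoints
  -- belong to `K`.
  have h₁ : (a K : ℝ) + j - 1 / 2 ∈ K.1 := h K ⟨by linarith, by linarith⟩
  have h₂ : (a K : ℝ) + j - 1 / 2 ∈ K'.1 := h K' ⟨by linarith, by linarith⟩
  exact Subtype.ext (hd.elim_set K.2 K'.2 _ h₁ h₂)

lemma separatedFreq_right (hd : 𝒦.PairwiseDisjoint id)
    (h : ∀ K : 𝒦, Ioo (a K : ℝ) ((a K : ℝ) + 6 * 2 ^ L K) ⊆ K.1) :
    SeparatedFreq (fun K => a K + 3 * 2 ^ (L K + 1)) L (-1) := by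
  intro K K' j j' hj₁ hj₂ hj₁' hj₂' he
  have hj₁ : (1 : ℝ) ≤ j := by exact_mod_cast hj₁
  have hj₂ : (j : ℝ) ≤ 6 * 2 ^ L K := by exact_mod_cast hj₂
  have hj₁' : (1 : ℝ) ≤ j' := by exact_mod_cast hj₁'
  have hj₂' : (j' : ℝ) ≤ 6 * 2 ^ L K' := by exact_mod_cast hj₂'
  have he : (a K : ℝ) + 3 * 2 ^ (L K + 1) + -1 * j = a K' + 3 * 2 ^ (L K' + 1) + -1 * j' := by
    exact_mod_cast he
  rw [pow_succ, pow_succ] at he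
  have h₁ : (a K : ℝ) + 6 * 2 ^ L K - j + 1 / 2 ∈ K.1 := h K ⟨by linarith, by linarith⟩
  have h₂ : (a K : ℝ) + 6 * 2 ^ L K - j + 1 / 2 ∈ K'.1 := h K' ⟨by linarith, by linarith⟩
  exact Subtype.ext (hd.elim_set K.2 K'.2 _ h₁ h₂)

/-- Here `j < |K|` must be strict: 0 may be an endpoint of `K` without belonging to it. -/
lemma left_freq_ne_zero (h0 : ∀ K ∈ 𝒦, (0 : ℝ) ∉ K)
    (h : ∀ K : 𝒦, Ioo (a K : ℝ) ((a K : ℝ) + 6 * 2 ^ L K) ⊆ K.1) (K : 𝒦) (j : ℕ) (hj₁ : 1 ≤ j)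
    (hj₂ : j < 6 * 2 ^ L K) : a K + 1 * (j : ℤ) ≠ 0 := by
  intro he
  have hj₁ : (1 : ℝ) ≤ j := by exact_mod_cast hj₁
  have hj₂ : (j : ℝ) < 6 * 2 ^ L K := by exact_mod_cast hj₂
  have he : (a K : ℝ) + 1 * j = 0 := by exact_mod_cast he
  exact h0 K K.2 (h K ⟨by linarith, by linarith⟩)

lemma right_freq_ne_zero (h0 : ∀ K ∈ 𝒦, (0 : ℝ) ∉ K)
    (h : ∀ K : 𝒦, Ioo (a K : ℝ) ((a K : ℝ) + 6 * 2 ^ L K) ⊆ K.1) (K : 𝒦) (j : ℕ) (hj₁ : 1 ≤ j)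
    (hj₂ : j < 6 * 2 ^ L K) : a K + 3 * 2 ^ (L K + 1) + -1 * (j : ℤ) ≠ 0 := by
  intro he
  have hj₁ : (1 : ℝ) ≤ j := by exact_mod_cast hj₁
  have hj₂ : (j : ℝ) < 6 * 2 ^ L K := by exact_mod_cast hj₂
  have he : (a K : ℝ) + 3 * 2 ^ (L K + 1) + -1 * j = 0 := by exact_mod_cast he
  rw [pow_succ] at he
  exact h0 K K.2 (h K ⟨by linarith, by linarith⟩)

/-- The frequencies with `j = 1` already force distinct anchors. Countability allows sums and
integrals to be exchanged. -/
lemma SeparatedFreq.countable {ι : Type*} {N : ι → ℤ} {L : ι → ℕ} {ε : ℤ}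
    (h : SeparatedFreq N L ε) : Countable ι := by
  refine Function.Injective.countable (f := N) fun k k' hk => ?_
  have h₁ : ∀ k, 1 ≤ 6 * 2 ^ L k := fun k => by
    have : 1 ≤ 2 ^ L k := Nat.one_le_two_pow
    omega
  exact h k k' 1 1 le_rfl (h₁ k) le_rfl (h₁ k') (by rw [hk])

end Disjoint

/-! ### Arcs -/

lemma arc_eq_preimage {a s : ℝ} (hs1 : s ≤ 1) :
    arc a s = (fun x => (AddCircle.measurableEquivIco 1 a x : ℝ)) ⁻¹' Iio (a + s) := by
  ext x
  constructor
  · rintro ⟨y, hy, rfl⟩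
    have hy' : y ∈ Ico a (a + 1) := ⟨hy.1, by linarith [hy.2]⟩
    have : AddCircle.measurableEquivIco 1 a (y : UnitAddCircle) = ⟨y, hy'⟩ :=
      (AddCircle.measurableEquivIco 1 a).apply_symm_apply ⟨y, hy'⟩
    simp only [mem_preimage, this]
    exact hy.2
  · intro hx
    refine ⟨AddCircle.measurableEquivIco 1 a x, ⟨(AddCircle.measurableEquivIco 1 a x).2.1, hx⟩, ?_⟩
    exact (AddCircle.measurableEquivIco 1 a).symm_apply_apply x

lemma measurableSet_arc {a s : ℝ} (hs1 : s ≤ 1) : MeasurableSet (arc a s) := by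
  rw [arc_eq_preimage hs1]
  exact (measurable_subtype_coe.comp (AddCircle.measurableEquivIco 1 a).measurable) measurableSet_Iio

lemma volume_arc {a s : ℝ} (hs1 : s ≤ 1) : volume (arc a s) = ENNReal.ofReal s := by
  rw [AddCircle.add_projection_respects_measure 1 a (measurableSet_arc hs1)]
  refine le_antisymm ?_ ?_
  · calc volume ((QuotientAddGroup.mk : ℝ → UnitAddCircle) ⁻¹' arc a s ∩ Ioc a (a + 1))
        -- The arc contains its starting point, which the fundamental domain `Ioc a (a + 1)`
        -- represents by `a + 1`.
        ≤ volume (Ioo a (a + s) ∪ {a + 1}) := by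
          refine measure_mono ?_
          rintro y ⟨⟨z, hz, hzy⟩, hy⟩
          have hzy' : ((z - y : ℝ) : UnitAddCircle) = 0 := by
            rw [AddCircle.coe_sub, sub_eq_zero]
            exact hzy
          obtain ⟨n, hn⟩ := (AddCircle.coe_eq_zero_iff 1).1 hzy'
          rw [zsmul_eq_mul, mul_one] at hn
          have h₁ : (-2 : ℝ) < n := by linarith [hz.1, hy.2]
          have h₂ : (n : ℝ) < 1 := by linarith [hz.2, hy.1]
          have h₁ : -2 < n := by exact_mod_cast h₁
          have h₂ : n < 1 := by exact_mod_cast h₂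
          obtain rfl | rfl : n = 0 ∨ n = -1 := by omega
          · rw [Int.cast_zero] at hn
            left
            exact ⟨hy.1, by linarith [hz.2]⟩
          · rw [Int.cast_neg, Int.cast_one] at hn
            right
            rw [mem_singleton_iff]
            linarith [hz.1, hy.2]
      _ ≤ volume (Ioo a (a + s)) + volume {a + 1} := measure_union_le _ _
      _ = ENNReal.ofReal s := by simp
  · calc ENNReal.ofReal s = volume (Ioo a (a + s)) := by simp
      _ ≤ _ := by
        refine measure_mono fun y hy => ⟨⟨y, ⟨hy.1.le, hy.2⟩, rfl⟩, hy.1, ?_⟩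
        linarith [hy.2]

lemma arc_one (a : ℝ) : arc a 1 = univ := AddCircle.coe_image_Ico_eq 1 a

lemma mem_arc_of_norm_lt {x₀ t : ℝ} {y : UnitAddCircle} (h : ‖y - x₀‖ < t / 2) :
    y ∈ arc (x₀ - t / 2) t := by
  obtain ⟨z, hz, hz'⟩ := exists_coe_eq_abs_eq_norm (y - x₀)
  rw [← hz', abs_lt] at h
  refine ⟨x₀ + z, ⟨by linarith, by linarith⟩, ?_⟩
  simp only [AddCircle.coe_add, hz]
  abel

lemma norm_sub_le_of_mem_arc {x₀ t : ℝ} {x : UnitAddCircle} (h : x ∈ arc (x₀ - t / 2) t) :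
    ‖x - x₀‖ ≤ t / 2 := by
  obtain ⟨z, hz, rfl⟩ := h
  have h₁ : ‖((z - x₀ : ℝ) : UnitAddCircle)‖ ≤ |z - x₀| := by
    rw [UnitAddCircle.norm_eq]
    simpa using round_le (z - x₀) 0
  simp only [AddCircle.coe_sub] at h₁
  refine h₁.trans ?_
  rw [abs_le]
  constructor <;> linarith [hz.1, hz.2]

lemma arc_subset_arc {x₀ t t' : ℝ} (h : t ≤ t') : arc (x₀ - t / 2) t ⊆ arc (x₀ - t' / 2) t' :=
  image_mono (Ico_subset_Ico (by linarith) (by linarith))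

/-! ### Growth of oscillations over concentric arcs -/

/-- The arc centred at `x₀` of length `min (2 ^ k * s) 1`. -/
def dilate (x₀ s : ℝ) (k : ℕ) : Set UnitAddCircle :=
  arc (x₀ - min (2 ^ k * s) 1 / 2) (min (2 ^ k * s) 1)

lemma measurableSet_dilate (x₀ s : ℝ) (k : ℕ) : MeasurableSet (dilate x₀ s k) :=
  measurableSet_arc (min_le_right _ _)

lemma volume_dilate (x₀ s : ℝ) (k : ℕ) :
    volume (dilate x₀ s k) = ENNReal.ofReal (min (2 ^ k * s) 1) :=
  volume_arc (min_le_right _ _)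

lemma dilate_subset_succ (x₀ : ℝ) {s : ℝ} (hs : 0 < s) (k : ℕ) :
    dilate x₀ s k ⊆ dilate x₀ s (k + 1) := by
  refine arc_subset_arc (min_le_min_right _ ?_)
  gcongr
  · norm_num
  · omega

lemma exists_mem_dilate_succ_of_notMem (x₀ : ℝ) {s : ℝ} (hs : 0 < s) {y : UnitAddCircle}
    (hy : y ∉ dilate x₀ s 1) : ∃ k, y ∈ dilate x₀ s (k + 2) ∧ y ∉ dilate x₀ s (k + 1) := by
  by_contra! h
  have h₁ : ∀ k, y ∉ dilate x₀ s (k + 1) := by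
    intro k
    induction k with
    | zero => exact hy
    | succ k ih => exact fun h' => ih (h k h')
  obtain ⟨k, hk⟩ := pow_unbounded_of_one_lt s⁻¹ (one_lt_two (α := ℝ))
  have h₂ : 1 ≤ 2 ^ (k + 1) * s := by
    have h₃ : 1 ≤ 2 ^ k * s := (inv_le_iff_one_le_mul₀ hs).1 hk.le
    have h₄ : (2 : ℝ) ^ (k + 1) * s = 2 * (2 ^ k * s) := by ring
    linarith
  apply h₁ k
  rw [dilate, min_eq_right h₂, arc_one]
  exact mem_univ y

lemma le_norm_sub_of_notMem_dilate {x₀ s : ℝ} (hs : 0 < s) (hs1 : s ≤ 1) {x y : UnitAddCircle}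
    (hx : x ∈ dilate x₀ s 0) {k : ℕ} (hy : y ∉ dilate x₀ s (k + 1)) :
    2 ^ (k + 1) * s / 4 ≤ ‖x - y‖ := by
  have hk : 2 ^ (k + 1) * s < 1 := by
    by_contra! h
    apply hy
    rw [dilate, min_eq_right h, arc_one]
    exact mem_univ y
  rw [dilate, min_eq_left hk.le] at hy
  rw [dilate, pow_zero, one_mul, min_eq_left hs1] at hx
  have h₁ : 2 ^ (k + 1) * s / 2 ≤ ‖y - x₀‖ := not_lt.1 fun h => hy (mem_arc_of_norm_lt h)
  have h₂ := norm_sub_le_of_mem_arc hx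
  have h₃ : ‖y - x₀‖ ≤ ‖x - y‖ + ‖x - x₀‖ := by
    rw [norm_sub_rev x y]
    exact norm_sub_le_norm_sub_add_norm_sub y x x₀
  have h₄ : (1 : ℝ) ≤ 2 ^ k := one_le_pow₀ one_le_two
  have h₅ : (2 : ℝ) ^ (k + 1) * s = 2 * (2 ^ k * s) := by ring
  have h₆ : s ≤ 2 ^ k * s := le_mul_of_one_le_left hs.le h₄
  linarith

lemma norm_average_sub_sq_le {u : UnitAddCircle → ℂ} (hu : MemLp u 2 volume)
    {B : Set UnitAddCircle} (hB0 : volume B ≠ 0) (c : ℂ) :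
    ‖(⨍ y in B, u y) - c‖ ^ 2 ≤ ⨍ y in B, ‖u y - c‖ ^ 2 := by
  have hsub : MemLp (fun y => u y - c) 2 (volume.restrict B) :=
    (hu.sub (memLp_const c)).restrict B
  have hconv : ConvexOn ℝ univ fun z : ℂ => ‖z‖ ^ 2 :=
    (convexOn_norm convex_univ).pow (fun _ _ => norm_nonneg _) 2
  have h := hconv.map_set_average_le (by fun_prop) isClosed_univ hB0 (measure_ne_top _ _)
    (f := fun y => u y - c) (Filter.Eventually.of_forall fun _ => mem_univ _)
    (hsub.integrable one_le_two) (hsub.integrable_norm_pow two_ne_zero)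
  have hav : ⨍ y in B, (u y - c) = (⨍ y in B, u y) - c := by
    have hv : (volume.real B : ℝ) ≠ 0 := (measureReal_ne_zero_iff).2 hB0
    rw [setAverage_eq, setAverage_eq, integral_sub
      ((hu.restrict B).integrable one_le_two) (integrable_const c), smul_sub]
    simp [hv]
  rwa [hav] at h

section Growth

variable {ρ : ℝ → ℝ} {A M : ℝ} {u : UnitAddCircle → ℂ} {x₀ s : ℝ}

/-- Jensen on the smaller arc, then enlargement of the domain; the factor 2 bounds the ratio of the
lengths. -/
lemma average_dilate_sub_sq_le (hu : MemLp u 2 volume)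
    (hosc : ∀ a t, 0 < t → t ≤ 1 →
      ∫ x in arc a t, ‖u x - ⨍ y in arc a t, u y‖ ^ 2 ≤ M ^ 2 * (ρ t ^ 2 * t))
    (hs : 0 < s) (k : ℕ) :
    ‖(⨍ y in dilate x₀ s k, u y) - ⨍ y in dilate x₀ s (k + 1), u y‖ ^ 2 ≤
      2 * M ^ 2 * ρ (min (2 ^ (k + 1) * s) 1) ^ 2 := by
  set t := min (2 ^ k * s) 1 with ht
  set t' := min (2 ^ (k + 1) * s) 1 with ht'
  have ht0 : 0 < t := lt_min (by positivity) one_pos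
  have ht0' : 0 < t' := lt_min (by positivity) one_pos
  have htt : t' ≤ 2 * t := by
    rw [ht, ht', mul_min_of_nonneg _ _ zero_le_two]
    refine min_le_min (le_of_eq (by ring)) (by norm_num)
  set c := ⨍ y in dilate x₀ s (k + 1), u y with hc
  have hv : volume.real (dilate x₀ s k) = t := by
    rw [measureReal_def, volume_dilate, ENNReal.toReal_ofReal ht0.le]
  have hv0 : volume (dilate x₀ s k) ≠ 0 := by
    rw [volume_dilate]
    exact (ENNReal.ofReal_pos.2 ht0).ne'
  have hint : Integrable fun y => ‖u y - c‖ ^ 2 :=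
    (hu.sub (memLp_const c)).integrable_norm_pow two_ne_zero
  calc ‖(⨍ y in dilate x₀ s k, u y) - c‖ ^ 2
      ≤ ⨍ y in dilate x₀ s k, ‖u y - c‖ ^ 2 := norm_average_sub_sq_le hu hv0 c
    _ = t⁻¹ * ∫ y in dilate x₀ s k, ‖u y - c‖ ^ 2 := by
        rw [setAverage_eq, hv, smul_eq_mul]
    _ ≤ t⁻¹ * ∫ y in dilate x₀ s (k + 1), ‖u y - c‖ ^ 2 := by
        refine mul_le_mul_of_nonneg_left ?_ (by positivity)
        exact setIntegral_mono_set hint.integrableOn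
          (Filter.Eventually.of_forall fun _ => by positivity)
          (dilate_subset_succ x₀ hs k).eventuallyLE
    _ ≤ t⁻¹ * (M ^ 2 * (ρ t' ^ 2 * t')) := by
        gcongr
        exact hosc _ _ ht0' (min_le_right _ _)
    _ ≤ t⁻¹ * (M ^ 2 * (ρ t' ^ 2 * (2 * t))) := by gcongr
    _ = 2 * M ^ 2 * ρ t' ^ 2 := by field_simp

lemma rho_min_le (hgrow : ∀ (j : ℕ) (s t : ℝ), 0 < s → s ≤ t → t ≤ 2 ^ j * s →
      ρ t ≤ A * (5 / 4) ^ j * ρ s) (hs : 0 < s) (hs1 : s ≤ 1) (k : ℕ) :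
    ρ (min (2 ^ k * s) 1) ≤ A * (5 / 4) ^ k * ρ s := by
  refine hgrow k s _ hs (le_min ?_ hs1) (min_le_left _ _)
  exact le_mul_of_one_le_left hs.le (one_le_pow₀ one_le_two)

/-- The increments between consecutive means are dominated by a geometric progression of ratio `5/4
> 1`, so their sum is comparable to its last term. The constant 8 closes the induction: `8 + 3/2 *
5/4 ≤ 8 * 5/4`. -/
lemma norm_average_dilate_sub_le (hu : MemLp u 2 volume) (hρ : ∀ t, 0 < t → 0 < ρ t)
    (hgrow : ∀ (j : ℕ) (s t : ℝ), 0 < s → s ≤ t → t ≤ 2 ^ j * s → ρ t ≤ A * (5 / 4) ^ j * ρ s)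
    (hM : 0 ≤ M)
    (hosc : ∀ a t, 0 < t → t ≤ 1 →
      ∫ x in arc a t, ‖u x - ⨍ y in arc a t, u y‖ ^ 2 ≤ M ^ 2 * (ρ t ^ 2 * t))
    (hs : 0 < s) (hs1 : s ≤ 1) (k : ℕ) :
    ‖(⨍ y in dilate x₀ s (k + 1), u y) - ⨍ y in dilate x₀ s 1, u y‖ ≤
      8 * (M * (A * ρ s)) * (5 / 4) ^ (k + 1) := by
  have hA : 0 ≤ A * ρ s := by
    have h := hgrow 0 s s hs le_rfl (by simp)
    rw [pow_zero, mul_one] at h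
    exact (hρ s hs).le.trans h
  induction k with
  | zero =>
    rw [zero_add, sub_self, norm_zero]
    positivity
  | succ k ih =>
    have h₁ := average_dilate_sub_sq_le (x₀ := x₀) hu hosc hs (k + 1)
    have h₂ := rho_min_le hgrow hs hs1 (k + 1 + 1)
    have h₀ : 0 < ρ (min (2 ^ (k + 1 + 1) * s) 1) := hρ _ (lt_min (by positivity) one_pos)
    have h₃ : ‖(⨍ y in dilate x₀ s (k + 1), u y) - ⨍ y in dilate x₀ s (k + 1 + 1), u y‖ ≤
        -- `3/2` is a rational bound for `√2`.
        3 / 2 * (M * (A * ρ s)) * (5 / 4) ^ (k + 1 + 1) := by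
      refine abs_le_of_sq_le_sq' ?_ (by positivity) |>.2
      refine h₁.trans ?_
      calc 2 * M ^ 2 * ρ (min (2 ^ (k + 1 + 1) * s) 1) ^ 2
          ≤ 2 * M ^ 2 * (A * (5 / 4) ^ (k + 1 + 1) * ρ s) ^ 2 := by gcongr
        _ = 2 * ((M * (A * ρ s)) * (5 / 4) ^ (k + 1 + 1)) ^ 2 := by ring
        _ ≤ (3 / 2 * (M * (A * ρ s)) * (5 / 4) ^ (k + 1 + 1)) ^ 2 := by
            nlinarith [sq_nonneg ((M * (A * ρ s)) * (5 / 4) ^ (k + 1 + 1))]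
    have h₄ := norm_sub_le_norm_sub_add_norm_sub (⨍ y in dilate x₀ s (k + 1 + 1), u y)
      (⨍ y in dilate x₀ s (k + 1), u y) (⨍ y in dilate x₀ s 1, u y)
    rw [norm_sub_rev] at h₃
    have h₅ : 0 ≤ M * (A * ρ s) * (5 / 4) ^ (k + 1) := by positivity
    have h₆ : (5 / 4 : ℝ) ^ (k + 1 + 1) = 5 / 4 * (5 / 4) ^ (k + 1) := pow_succ' _ _
    rw [h₆] at h₃ ⊢
    linarith

lemma integral_dilate_le (hu : MemLp u 2 volume) (hρ : ∀ t, 0 < t → 0 < ρ t)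
    (hgrow : ∀ (j : ℕ) (s t : ℝ), 0 < s → s ≤ t → t ≤ 2 ^ j * s → ρ t ≤ A * (5 / 4) ^ j * ρ s)
    (hM : 0 ≤ M)
    (hosc : ∀ a t, 0 < t → t ≤ 1 →
      ∫ x in arc a t, ‖u x - ⨍ y in arc a t, u y‖ ^ 2 ≤ M ^ 2 * (ρ t ^ 2 * t))
    (hs : 0 < s) (hs1 : s ≤ 1) (k : ℕ) :
    ∫ x in dilate x₀ s (k + 1), ‖u x - ⨍ y in dilate x₀ s 1, u y‖ ^ 2 ≤
      130 * (M * (A * ρ s)) ^ 2 * (25 / 8) ^ (k + 1) * s := by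
  set c := ⨍ y in dilate x₀ s (k + 1), u y with hc
  set c₁ := ⨍ y in dilate x₀ s 1, u y with hc₁
  set t := min (2 ^ (k + 1) * s) 1 with ht
  have ht0 : 0 < t := lt_min (by positivity) one_pos
  have ht1 : t ≤ 2 ^ (k + 1) * s := min_le_left _ _
  have hρt : ρ t ≤ A * (5 / 4) ^ (k + 1) * ρ s := rho_min_le hgrow hs hs1 (k + 1)
  have hρ0 := hρ t ht0
  have hv : volume.real (dilate x₀ s (k + 1)) = t := by
    rw [measureReal_def, volume_dilate, ENNReal.toReal_ofReal ht0.le]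
  have hint : ∀ z : ℂ, Integrable (fun y => ‖u y - z‖ ^ 2) (volume.restrict (dilate x₀ s (k + 1))) :=
    fun z => ((hu.sub (memLp_const z)).integrable_norm_pow two_ne_zero).integrableOn
  have hd := norm_average_dilate_sub_le (x₀ := x₀) hu hρ hgrow hM hosc hs hs1 k
  have ho : ∫ x in dilate x₀ s (k + 1), ‖u x - c‖ ^ 2 ≤ M ^ 2 * (ρ t ^ 2 * t) :=
    hosc _ _ ht0 (min_le_right _ _)
  calc ∫ x in dilate x₀ s (k + 1), ‖u x - c₁‖ ^ 2
      ≤ ∫ x in dilate x₀ s (k + 1), (2 * ‖u x - c‖ ^ 2 + 2 * ‖c - c₁‖ ^ 2) := by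
        refine integral_mono (hint c₁) (((hint c).const_mul 2).add (integrable_const _)) fun x => ?_
        have h₁ := norm_sub_le_norm_sub_add_norm_sub (u x) c c₁
        have h₂ := norm_nonneg (u x - c₁)
        simp only
        nlinarith [sq_nonneg (‖u x - c‖ - ‖c - c₁‖)]
    _ = 2 * (∫ x in dilate x₀ s (k + 1), ‖u x - c‖ ^ 2) + 2 * ‖c - c₁‖ ^ 2 * t := by
        rw [integral_add ((hint c).const_mul 2) (integrable_const _), integral_const_mul,
          integral_const, measureReal_restrict_apply_univ, hv, smul_eq_mul]
        ring
    -- Oscillation and drift of the mean contribute `2 + 2 * 8 ^ 2 = 130`.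
    _ ≤ 2 * (M ^ 2 * ((A * (5 / 4) ^ (k + 1) * ρ s) ^ 2 * t)) +
          2 * (8 * (M * (A * ρ s)) * (5 / 4) ^ (k + 1)) ^ 2 * t := by
        gcongr
        refine ho.trans ?_
        gcongr
    _ = 130 * (M * (A * ρ s)) ^ 2 * ((5 / 4) ^ (k + 1)) ^ 2 * t := by ring
    _ ≤ 130 * (M * (A * ρ s)) ^ 2 * ((5 / 4) ^ (k + 1)) ^ 2 * (2 ^ (k + 1) * s) := by gcongr
    _ = 130 * (M * (A * ρ s)) ^ 2 * (25 / 8) ^ (k + 1) * s := by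
        have : (25 / 8 : ℝ) ^ (k + 1) = ((5 / 4) ^ (k + 1)) ^ 2 * 2 ^ (k + 1) := by
          rw [← pow_mul, mul_comm (k + 1) 2, pow_mul, ← mul_pow]
          norm_num
        rw [this]
        ring

end Growth

/-! ### The square function on an arc -/

lemma lintegral_enorm_sq_le_ofReal {α : Type*} [MeasurableSpace α] {μ : Measure α} {f : α → ℂ}
    (hf : MemLp f 2 μ) {C : ℝ} (h : ∫ x, ‖f x‖ ^ 2 ∂μ ≤ C) :
    ∫⁻ x, ‖f x‖ₑ ^ 2 ∂μ ≤ ENNReal.ofReal C := by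
  have hint : Integrable (fun t => ‖f t‖ ^ 2) μ := hf.integrable_norm_pow two_ne_zero
  refine le_trans (le_of_eq ?_) (ENNReal.ofReal_le_ofReal h)
  rw [ofReal_integral_eq_lintegral_ofReal hint (Filter.Eventually.of_forall fun _ => sq_nonneg _)]
  refine lintegral_congr fun t => ?_
  rw [ENNReal.ofReal_pow (norm_nonneg _), ofReal_norm]

section Far

variable {x₀ s R : ℝ} {v : UnitAddCircle → ℂ}

lemma tsum_ofReal_geometric_growth {a : ℝ} (ha : 0 ≤ a) :
    ∑' k : ℕ, ENNReal.ofReal (a * (25 / 32) ^ k) = ENNReal.ofReal (a * (32 / 7)) := by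
  have hgeom : HasSum (fun k : ℕ => a * (25 / 32) ^ k) (a * (32 / 7)) := by
    have := (hasSum_geometric_of_lt_one (r := (25 / 32 : ℝ)) (by norm_num) (by norm_num)).mul_left a
    norm_num at this ⊢
    exact this
  rw [← hgeom.tsum_eq, ENNReal.ofReal_tsum_of_nonneg (fun _ => by positivity) hgeom.summable]

/-- The part of a function away from an arc, against the inverse square of the distance. -/
lemma lintegral_far_le (hv : MemLp v 2 volume) (hs : 0 < s) (hs1 : s ≤ 1)
    (hgrowth : ∀ k, ∫ x in dilate x₀ s (k + 1), ‖v x‖ ^ 2 ≤ 130 * R ^ 2 * (25 / 8) ^ (k + 1) * s)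
    {x : UnitAddCircle} (hx : x ∈ dilate x₀ s 0) :
    ∫⁻ y, ‖(dilate x₀ s 1)ᶜ.indicator v y‖ₑ ^ 2 *
      ENNReal.ofReal ((1 / (4 * ‖x - y‖)) ^ 2) ≤ ENNReal.ofReal (1500 * R ^ 2 / s) := by
  -- Bound for the kernel off `dilate x₀ s (k + 1)`, where `‖x - y‖ ≥ 2 ^ (k + 1) * s / 4`.
  set w : ℕ → ℝ := fun k => (1 / (2 ^ (k + 1) * s)) ^ 2 with hw
  have hmeas : ∀ k, AEMeasurable (fun y => (dilate x₀ s (k + 2)).indicator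
      (fun y => ENNReal.ofReal (w k) * ‖v y‖ₑ ^ 2) y) volume := fun k =>
    ((hv.aestronglyMeasurable.aemeasurable.enorm.pow_const 2).const_mul _).indicator
      (measurableSet_dilate _ _ _)
  calc ∫⁻ y, ‖(dilate x₀ s 1)ᶜ.indicator v y‖ₑ ^ 2 * ENNReal.ofReal ((1 / (4 * ‖x - y‖)) ^ 2)
      ≤ ∫⁻ y, ∑' k, (dilate x₀ s (k + 2)).indicator
          (fun y => ENNReal.ofReal (w k) * ‖v y‖ₑ ^ 2) y := by
        refine lintegral_mono fun y => ?_
        by_cases hy : y ∈ dilate x₀ s 1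
        · simp [hy]
        · obtain ⟨k, hk, hk'⟩ := exists_mem_dilate_succ_of_notMem x₀ hs hy
          refine le_trans ?_ (ENNReal.le_tsum k)
          have hd := le_norm_sub_of_notMem_dilate hs hs1 hx hk'
          rw [indicator_of_mem (mem_compl hy), indicator_of_mem hk, mul_comm]
          have h0 : 0 < 2 ^ (k + 1) * s := by positivity
          refine mul_le_mul_left (ENNReal.ofReal_le_ofReal ?_) _
          rw [hw]
          dsimp only
          exact pow_le_pow_left₀ (by positivity) (one_div_le_one_div_of_le h0 (by linarith)) 2
    _ = ∑' k, ENNReal.ofReal (w k) * ∫⁻ y in dilate x₀ s (k + 2), ‖v y‖ₑ ^ 2 := by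
        rw [lintegral_tsum hmeas]
        refine tsum_congr fun k => ?_
        rw [lintegral_indicator (measurableSet_dilate _ _ _), lintegral_const_mul' _ _
          ENNReal.ofReal_ne_top]
    _ ≤ ∑' k : ℕ, ENNReal.ofReal (130 * (625 / 256) * R ^ 2 / s * (25 / 32) ^ k) := by
        refine ENNReal.tsum_le_tsum fun k => ?_
        refine (mul_le_mul_right (lintegral_enorm_sq_le_ofReal (hv.restrict _)
          (hgrowth (k + 1))) _).trans ?_
        rw [← ENNReal.ofReal_mul (by positivity)]
        apply ENNReal.ofReal_le_ofReal
        apply le_of_eq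
        have h₁ : (25 / 32 : ℝ) ^ k = (25 / 8) ^ k / (2 ^ k) ^ 2 := by
          rw [← pow_mul, mul_comm k 2, pow_mul, ← div_pow]
          norm_num
        rw [hw, h₁]
        simp only [pow_succ]
        field_simp
        ring
    _ = ENNReal.ofReal (130 * (625 / 256) * R ^ 2 / s * (32 / 7)) :=
        tsum_ofReal_geometric_growth (by positivity)
    _ ≤ ENNReal.ofReal (1500 * R ^ 2 / s) := by
        apply ENNReal.ofReal_le_ofReal
        have h : 0 ≤ R ^ 2 / s := by positivity
        calc 130 * (625 / 256) * R ^ 2 / s * (32 / 7)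
            = 130 * (625 / 256) * (32 / 7) * (R ^ 2 / s) := by ring
          _ ≤ 1500 * (R ^ 2 / s) := by gcongr; norm_num
          _ = _ := by ring

lemma fourierCoeff_eq_add_of_eq_const_add {u f g : UnitAddCircle → ℂ} {c : ℂ}
    (hf : MemLp f 2 volume) (hg : MemLp g 2 volume) (h : ∀ x, u x = c + (f x + g x)) {n : ℤ}
    (hn : n ≠ 0) : fourierCoeff u n = fourierCoeff f n + fourierCoeff g n := by
  have hf' : Integrable f AddCircle.haarAddCircle :=
    volume_eq_haarAddCircle ▸ hf.integrable one_le_two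
  have hg' : Integrable g AddCircle.haarAddCircle :=
    volume_eq_haarAddCircle ▸ hg.integrable one_le_two
  have hu : u = (fun x => c * fourier 0 x) + (f + g) := by
    ext x
    simp [h]
  have hc : Integrable (fun x : UnitAddCircle => c * fourier 0 x) AddCircle.haarAddCircle := by
    simp only [fourier_zero]
    exact integrable_const _
  rw [hu, fourierCoeff.add hc (hf'.add hg'), fourierCoeff.add hf' hg']
  simp only [Pi.add_apply]
  rw [fourierCoeff.const_mul, fourierCoeff_fourier]
  simp [hn]

/-- The cut is made at the doubled arc, which leaves a gap of `s / 2` between the arc and the far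
part. The near part is bounded in `L²`, the far part uniformly on the arc, by `48 s * 1500 R ^ 2 /
s`. -/
lemma lintegral_arc_blockSquare_le {ι : Type*} [Countable ι] {N : ι → ℤ} {L : ι → ℕ} {ε : ℤ}
    (hsep : SeparatedFreq N L ε) (hε : |ε| = 1)
    (h0 : ∀ k (j : ℕ), 1 ≤ j → j < 6 * 2 ^ L k → N k + ε * j ≠ 0)
    {u : UnitAddCircle → ℂ} (hu : MemLp u 2 volume) {c : ℂ} (hs : 0 < s) (hs1 : s ≤ 1)
    (hgrowth : ∀ k, ∫ x in dilate x₀ s (k + 1), ‖u x - c‖ ^ 2 ≤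
      130 * R ^ 2 * (25 / 8) ^ (k + 1) * s) :
    ∫⁻ x in dilate x₀ s 0, blockSquare N L ε (fourierCoeff u) s x ≤
      ENNReal.ofReal (150000 * R ^ 2 * s) := by
  have hv : MemLp (fun x => u x - c) 2 volume := hu.sub (memLp_const c)
  have hm := measurableSet_dilate x₀ s 1
  set f := (dilate x₀ s 1).indicator fun x => u x - c with hf
  set g := (dilate x₀ s 1)ᶜ.indicator fun x => u x - c with hg
  have hf2 : MemLp f 2 volume := hv.indicator hm
  have hg2 : MemLp g 2 volume := hv.indicator hm.compl
  have hsum : ∀ n ≠ 0, fourierCoeff u n = fourierCoeff f n + fourierCoeff g n := fun n hn =>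
    fourierCoeff_eq_add_of_eq_const_add hf2 hg2 (c := c) (fun x => by
      by_cases hx : x ∈ dilate x₀ s 1 <;> simp [hf, hg, hx]) hn
  have hnear : ∫⁻ x in dilate x₀ s 0, blockSquare N L ε (fourierCoeff f) s x ≤
      ENNReal.ofReal (130 * R ^ 2 * (25 / 8) * s) := by
    calc ∫⁻ x in dilate x₀ s 0, blockSquare N L ε (fourierCoeff f) s x
        ≤ ∫⁻ x, blockSquare N L ε (fourierCoeff f) s x := setLIntegral_le_lintegral _ _
      _ ≤ ∑' n, ‖fourierCoeff f n‖ₑ ^ 2 := lintegral_blockSquare_le hsep hε _ _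
      _ = ∫⁻ x, ‖f x‖ₑ ^ 2 := tsum_enorm_fourierCoeff_sq hf2
      _ = ∫⁻ x in dilate x₀ s 1, ‖u x - c‖ₑ ^ 2 := by
          rw [← lintegral_indicator hm]
          refine lintegral_congr fun x => ?_
          by_cases hx : x ∈ dilate x₀ s 1 <;> simp [hf, hx]
      _ ≤ _ := lintegral_enorm_sq_le_ofReal (hv.restrict _) (by simpa using hgrowth 0)
  have hfar : ∫⁻ x in dilate x₀ s 0, blockSquare N L ε (fourierCoeff g) s x ≤
      ENNReal.ofReal (72000 * R ^ 2 * s) := by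
    calc ∫⁻ x in dilate x₀ s 0, blockSquare N L ε (fourierCoeff g) s x
        ≤ ∫⁻ _ in dilate x₀ s 0, ENNReal.ofReal (72000 * R ^ 2) := by
          refine setLIntegral_mono measurable_const fun x hx => ?_
          have hvan : ∀ y, ‖x - y‖ < s / 2 → g y = 0 := by
            intro y hy
            refine indicator_of_notMem (fun hy' => ?_) _
            have := le_norm_sub_of_notMem_dilate (k := 0) hs hs1 hx hy'
            norm_num at this
            linarith
          refine (blockSquare_le_of_eq_zero hsep hε hg2 (by positivity : 0 < s / 2) hs hvan).trans ?_
          refine (mul_le_mul_right (lintegral_far_le hv hs hs1 hgrowth hx) _).trans ?_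
          rw [← ENNReal.ofReal_mul (by positivity)]
          apply ENNReal.ofReal_le_ofReal
          apply le_of_eq
          field_simp
          ring
      _ = ENNReal.ofReal (72000 * R ^ 2 * s) := by
          rw [setLIntegral_const, volume_dilate, pow_zero, one_mul, min_eq_left hs1,
            ← ENNReal.ofReal_mul (by positivity)]
  calc ∫⁻ x in dilate x₀ s 0, blockSquare N L ε (fourierCoeff u) s x
      ≤ ∫⁻ x in dilate x₀ s 0, 2 * (blockSquare N L ε (fourierCoeff f) s x +
          blockSquare N L ε (fourierCoeff g) s x) :=
        lintegral_mono fun x => blockSquare_le_two_mul_add hsum h0 s x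
    _ = 2 * ((∫⁻ x in dilate x₀ s 0, blockSquare N L ε (fourierCoeff f) s x) +
          ∫⁻ x in dilate x₀ s 0, blockSquare N L ε (fourierCoeff g) s x) := by
        rw [lintegral_const_mul' _ _ (by simp), lintegral_add_left (measurable_blockSquare _ _)]
    _ ≤ ENNReal.ofReal 2 * (ENNReal.ofReal (130 * R ^ 2 * (25 / 8) * s) +
          ENNReal.ofReal (72000 * R ^ 2 * s)) := by
        rw [ENNReal.ofReal_ofNat]
        gcongr
    _ = ENNReal.ofReal (2 * (130 * R ^ 2 * (25 / 8) * s + 72000 * R ^ 2 * s)) := by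
        rw [← ENNReal.ofReal_add (by positivity) (by positivity), ← ENNReal.ofReal_mul zero_le_two]
    _ ≤ ENNReal.ofReal (150000 * R ^ 2 * s) := by
        apply ENNReal.ofReal_le_ofReal
        have : 0 ≤ R ^ 2 * s := by positivity
        linarith

end Far

/-- The Carleson bound for an arbitrary weight that grows slowly. -/
lemma carlesonSup_squareFun_le {ρ : ℝ → ℝ} {A : ℝ} (hρ : ∀ t, 0 < t → 0 < ρ t)
    (hgrow : ∀ (j : ℕ) (s t : ℝ), 0 < s → s ≤ t → t ≤ 2 ^ j * s → ρ t ≤ A * (5 / 4) ^ j * ρ s)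
    {𝒦 : Set (Set ℝ)} (hK : ∀ K ∈ 𝒦, K.OrdConnected ∧
      ∃ (a : ℤ) (l : ℕ), IsGLB K (a : ℝ) ∧ IsLUB K ((a : ℝ) + 3 * 2 ^ (l + 1)))
    (hd : 𝒦.PairwiseDisjoint id) (h0 : ∀ K ∈ 𝒦, (0 : ℝ) ∉ K)
    {u : UnitAddCircle → ℂ} (hu : MemLp u 2 volume)
    (hfin : carlesonSup ρ (fun a s x => ‖u x - ⨍ y in arc a s, u y‖ₑ ^ 2) ≠ ∞) :
    carlesonSup ρ (fun _ s x => squareFun 𝒦 u s x) ≤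
      ENNReal.ofReal (300000 * A ^ 2) *
        carlesonSup ρ (fun a s x => ‖u x - ⨍ y in arc a s, u y‖ₑ ^ 2) := by
  set S := carlesonSup ρ (fun a s x => ‖u x - ⨍ y in arc a s, u y‖ₑ ^ 2) with hS
  set M := Real.sqrt S.toReal with hM
  have hM0 : 0 ≤ M := Real.sqrt_nonneg _
  have hMS : ENNReal.ofReal (M ^ 2) = S := by
    rw [hM, Real.sq_sqrt ENNReal.toReal_nonneg, ENNReal.ofReal_toReal hfin]
  have hosc : ∀ a t, 0 < t → t ≤ 1 →
      ∫ x in arc a t, ‖u x - ⨍ y in arc a t, u y‖ ^ 2 ≤ M ^ 2 * (ρ t ^ 2 * t) := by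
    intro a t ht ht1
    have hρt := hρ t ht
    have hle : (∫⁻ x in arc a t, ‖u x - ⨍ y in arc a t, u y‖ₑ ^ 2) /
        ENNReal.ofReal (ρ t ^ 2 * t) ≤ S := by
      rw [hS]
      unfold carlesonSup
      exact le_iSup_of_le a (le_iSup_of_le t (le_iSup_of_le ht (le_iSup_of_le ht1 le_rfl)))
    have hpos : 0 < ρ t ^ 2 * t := by positivity
    rw [ENNReal.div_le_iff (ENNReal.ofReal_pos.2 hpos).ne' ENNReal.ofReal_ne_top, ← hMS,
      ← ENNReal.ofReal_mul (by positivity)] at hle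
    have hmem : MemLp (fun x => u x - ⨍ y in arc a t, u y) 2 (volume.restrict (arc a t)) :=
      (hu.sub (memLp_const _)).restrict _
    have hint : Integrable (fun x => ‖u x - ⨍ y in arc a t, u y‖ ^ 2)
      (volume.restrict (arc a t)) := hmem.integrable_norm_pow two_ne_zero
    rw [← ENNReal.ofReal_le_ofReal_iff (by positivity), ofReal_integral_eq_lintegral_ofReal hint
      (Filter.Eventually.of_forall fun _ => sq_nonneg _)]
    refine le_trans (le_of_eq (lintegral_congr fun x => ?_)) hle
    rw [ENNReal.ofReal_pow (norm_nonneg _), ofReal_norm]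
  have hc : ∀ K : 𝒦, K.1.OrdConnected := fun K => (hK K K.2).1
  choose a L ha hb using fun K : 𝒦 => (hK K K.2).2
  have hsub := Ioo_subset_of_endpoints hc ha hb
  have hsepl := separatedFreq_left hd hsub
  have hsepr := separatedFreq_right hd hsub
  have : Countable 𝒦 := hsepl.countable
  refine iSup_le fun α => iSup_le fun s => iSup_le fun hs => iSup_le fun hs1 => ?_
  have hρs := hρ s hs
  have hpos : 0 < ρ s ^ 2 * s := by positivity
  rw [ENNReal.div_le_iff (ENNReal.ofReal_pos.2 hpos).ne' ENNReal.ofReal_ne_top, ← hMS,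
    ← ENNReal.ofReal_mul (by positivity), ← ENNReal.ofReal_mul (by positivity)]
  have harc : arc α s = dilate (α + s / 2) s 0 := by
    rw [dilate, pow_zero, one_mul, min_eq_left hs1, add_sub_cancel_right]
  have hgrowth := integral_dilate_le (x₀ := α + s / 2) hu hρ hgrow hM0 hosc hs hs1
  rw [harc]
  calc ∫⁻ x in dilate (α + s / 2) s 0, squareFun 𝒦 u s x
      ≤ ∫⁻ x in dilate (α + s / 2) s 0, (blockSquare a L 1 (fourierCoeff u) s x +
          blockSquare (fun K => a K + 3 * 2 ^ (L K + 1)) L (-1) (fourierCoeff u) s x) :=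
        lintegral_mono fun x => squareFun_le ha hb (hu.integrable one_le_two) hs hs1 x
    _ = (∫⁻ x in dilate (α + s / 2) s 0, blockSquare a L 1 (fourierCoeff u) s x) +
          ∫⁻ x in dilate (α + s / 2) s 0,
            blockSquare (fun K => a K + 3 * 2 ^ (L K + 1)) L (-1) (fourierCoeff u) s x :=
        lintegral_add_left (measurable_blockSquare _ _) _
    _ ≤ ENNReal.ofReal (150000 * (M * (A * ρ s)) ^ 2 * s) +
          ENNReal.ofReal (150000 * (M * (A * ρ s)) ^ 2 * s) :=
        add_le_add
          (lintegral_arc_blockSquare_le hsepl (by simp) (left_freq_ne_zero h0 hsub) hu hs hs1 hgrowth)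
          (lintegral_arc_blockSquare_le hsepr (by simp) (right_freq_ne_zero h0 hsub) hu hs hs1
            hgrowth)
    _ = ENNReal.ofReal (300000 * A ^ 2 * M ^ 2 * (ρ s ^ 2 * s)) := by
        rw [← ENNReal.ofReal_add (by positivity) (by positivity)]
        congr 1
        ring

end LogBMO

theorem mainTheorem6 (r : ℝ) (hr : 0 ≤ r) :
    ∃ C : ℝ, 0 < C ∧
      ∀ 𝒦 : Set (Set ℝ),
        (∀ K ∈ 𝒦, K.OrdConnected ∧
          ∃ (a : ℤ) (l : ℕ), IsGLB K (a : ℝ) ∧ IsLUB K ((a : ℝ) + 3 * 2 ^ (l + 1))) →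
        𝒦.PairwiseDisjoint id →
        (∀ K ∈ 𝒦, (0 : ℝ) ∉ K) →
        ∀ u : UnitAddCircle → ℂ, LogBMO.MemBMO (LogBMO.rho (LogBMO.psi r)) u →
          (LogBMO.carlesonSup (LogBMO.rho (LogBMO.psi r))
              (fun _ s x => LogBMO.squareFun 𝒦 u s x)) ^ (1 / 2 : ℝ) ≤
            ENNReal.ofReal C * LogBMO.bmoNorm (LogBMO.rho (LogBMO.psi r)) u := by
  obtain ⟨A, hA, hgrow⟩ := LogBMO.exists_rho_psi_le hr
  -- The square root of the constant in the bound for squared quantities; `A` depends only on `r`.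
  refine ⟨(300000 * A ^ 2) ^ (1 / 2 : ℝ), by positivity, fun 𝒦 hK hd h0 u hu => ?_⟩
  have hfin := hu.2
  unfold LogBMO.bmoNorm at hfin ⊢
  rw [ENNReal.rpow_lt_top_iff_of_pos (by norm_num)] at hfin
  rw [← ENNReal.ofReal_rpow_of_pos (by positivity),
    ← ENNReal.mul_rpow_of_nonneg _ _ (by norm_num : (0 : ℝ) ≤ 1 / 2)]
  exact ENNReal.rpow_le_rpow (LogBMO.carlesonSup_squareFun_le (fun t ht => LogBMO.rho_psi_pos hr ht)
    hgrow hK hd h0 hu.1 hfin.ne) (by norm_num)
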